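/- **Algebras.** All algebras have type $\langle\vee,\wedge,\to,{}',0,1\rangle$; write $x^*:=x\to 0$, and $x\le y$ for $x\wedge y=x$. A *semi-Heyting algebra* is a lattice with $0,1$ satisfying $x\wedge(x\to y)\approx x\wedge y$, $x\wedge(y\to z)\approx x\wedge[(x\wedge y)\to(x\wedge z)]$, $x\to x\approx1$. Let $\mathbb{RUNO}1$ be the variety of all algebras whose $\langle\vee,\wedge,\to,0,1\rangle$-reduct is semi-Heyting and which satisfy $0'\approx1$, $1'\approx0$, $(x\wedge y)'\approx x'\vee y'$, $(x\vee y)''\approx x''\vee y''$, $x''\approx x$, $(0\to1)'\approx0\to1$, $x\wedge x'{}^*{}'\le y\vee y^*$ and $x\wedge x'{}^*\approx(x\wedge x'{}^*)'{}^*$. A variety is a class closed under homomorphic images, subalgebras and direct products; $\mathbb V(K)$ is the least variety containing $K$; a variety is nontrivial if it has a member with more than one element. Let $\mathbf{A1},\dots,\mathbf{A4}$ be the algebras on the chain $0<2<1$ with $0'=1$, $1'=0$, $2'=2$, $x\to x=1$, $1\to x=x$, $2\to0=0$, $0\to1=2$, and with $(0\to2,\;2\to1)$ equal to $(1,1)$,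 $(1,2)$, $(2,1)$, $(2,2)$ respectively. Let $\mathbf{A5}$ be the algebra on the four-element Boolean lattice with atoms $2,3$, with $0'=1$, $1'=0$, $2'=2$, $3'=3$, and with rows of $\to$ (left argument $0,1,2,3$; right argument running through $0,1,2,3$): $(1,2,1,2)$, $(0,1,2,3)$, $(3,2,1,0)$, $(2,1,2,1)$. **Logics.** Formulas are built from countably many variables with $\vee,\wedge,\to,\sim,\bot,\top$ (interpreted in algebras as $\vee,\wedge,\to,{}',0,1$). Write $\neg\phi:=\phi\to\bot$, $\phi\to_H\psi:=\phi\to(\phi\wedge\psi)$ and $\phi\leftrightarrow_H\psi:=(\phi\to_H\psi)\wedge(\psi\to_H\phi)$. The logic $\mathcal{RUNO}1$ has the rules "from $\phi$ and $\phi\to_H\psi$ deduce $\psi$" and "from $\phi\to_H\psi$ deduce ${\sim}\psi\to_H{\sim}\phi$" (both applicable also to formulas derived from premises) and as axioms all substitution instances of: - $p\to_H(p\vee q)$; $q\to_H(p\vee q)$; $(p\to_Hr)\to_H[(q\to_Hr)\to_H((p\vee q)\to_Hr)]$; $(p\wedge q)\to_Hp$; $(r\to_Hp)\to_H[(r\to_Hq)\to_H(r\to_H(p\wedge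 q))]$; $\top$; $\bot\to_Hp$; $[(p\wedge q)\to_Hr]\to_H[p\to_H(q\to_Hr)]$; $[p\to_H(q\to_Hr)]\to_H[(p\wedge q)\to_Hr]$; $(p\to_Hq)\to_H[(q\to_Hp)\to_H((p\to r)\to_H(q\to r))]$; $(p\to_Hq)\to_H[(q\to_Hp)\to_H((r\to q)\to_H(r\to p))]$; - $\top\leftrightarrow_H{\sim}\bot$; ${\sim}(p\wedge q)\leftrightarrow_H({\sim}p\vee{\sim}q)$; ${\sim}(p\vee q)\leftrightarrow_H({\sim}p\wedge{\sim}q)$; ${\sim}{\sim}p\leftrightarrow_Hp$; - ${\sim}(\bot\to\top)\leftrightarrow_H(\bot\to\top)$; $[(p\wedge{\sim}\neg{\sim}p)\vee(q\vee\neg q)]\leftrightarrow_H(q\vee\neg q)$; $\neg{\sim}(p\wedge\neg{\sim}p)\leftrightarrow_H(p\wedge\neg{\sim}p)$. An axiomatic extension of $\mathcal{RUNO}1$ adds further axioms (closed under substitution) and keeps the rules. A logic $\vdash$ is *the logic of* a variety $\mathbb V$ if $\mathbb V$ is an equivalent algebraic semantics of it with defining identity $x\approx1$ and equivalence formulas $x\to_Hy,\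 y\to_Hx$; that is: for all sets $\Gamma$ of formulas and all formulas $\phi$, $\Gamma\vdash\phi$ iff in every $\mathbf A\in\mathbb V$ every interpretation sending all of $\Gamma$ to $1$ sends $\phi$ to $1$; and for all $\phi,\psi$, every interpretation in a member of $\mathbb V$ gives $\phi,\psi$ the same value iff it sends both $\phi\to_H\psi$ and $\psi\to_H\phi$ to $1$. It is *decidable* if there is an algorithm deciding, for finite $\Gamma$ and $\phi$, whether $\Gamma\vdash\phi$ (in particular, whether $\phi$ is a theorem). Let $\alpha:=\bot\to\top$, $\beta:=\bot\to\alpha$, $\gamma:=\bot\to\beta$, and $$\begin{aligned}(e_1)&\ \neg\alpha\leftrightarrow_H\bot, & (e_2)&\ (\beta\to\neg\neg\alpha)\leftrightarrow_H\neg\neg\alpha, & (e_3)&\ (\alpha\to\top)\to_H\beta,\\ (e_4)&\ (\neg\alpha\to(\alpha\to\top))\leftrightarrow_H\alpha, & (e_5)&\ ((\alpha\to\beta)\to\alpha)\leftrightarrow_H\beta.\end{aligned}$$ **Theorem.** (A) For each nonempty $S\subseteq\{1,\dots,5\}$ (written as a string of digits), the axiomatic extension of $\mathcal{RUNO}1$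 by the formulas listed below is the logic of $\mathbb V(\{\mathbf Ai:i\in S\})$: - $1$: $\alpha\to\top$, $\beta$. $\;2$: $\beta$, $(\alpha\to\top)\leftrightarrow_H\alpha$, $e_1$. $\;3$: $[p\to(p\to(p\to q))]\leftrightarrow_H[p\to(p\to q)]$. $\;4$: ${\sim}(\alpha\to\top)\leftrightarrow_H\beta$. $\;5$: $\neg\alpha\to\top$. - $12$: $e_1,\beta$. $\;13$: $e_1,\ \alpha\to\top$. $\;14$: $e_1,\ \beta\leftrightarrow_H(\alpha\to\top)$. $\;15$: $e_2,e_3,e_4$. $\;23$: $e_1,e_2,e_5$. $\;24$: $e_1,e_3,e_5$. $\;25$: $(\alpha\to\beta)\leftrightarrow_H\alpha,\ e_3,e_5$. $\;34$: $e_1,\ \beta\leftrightarrow_H\alpha,\ e_5$. $\;35$: $e_2,e_4,e_5$. $\;45$: $e_3,e_4,e_5$. - $123$: $e_1,e_2$. $\;124$: $e_1,e_3$. $\;125$: $e_2,e_3$. $\;134$: $e_1,\ \gamma\leftrightarrow_H\alpha,\ e_4$. $\;135$: $e_4,e_2$. $\;145$: $e_3,e_4$. $\;234$: $e_1,e_5$.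 $\;235$: $e_2,e_5$. $\;245$: $e_3,e_5$. $\;345$: $e_4,e_5$. - $1234$: $e_1$. $\;1235$: $e_2$. $\;1245$: $e_3$. $\;1345$: $e_4$. $\;2345$: $e_5$. $\;12345$: no additional axiom. (B) The varieties $\mathbb V(\{\mathbf Ai:i\in S\})$, for nonempty $S\subseteq\{1,\dots,5\}$, are pairwise distinct and are exactly the nontrivial subvarieties of $\mathbb{RUNO}1$; there are 31 of them. (C) The logic of every subvariety of $\mathbb{RUNO}1$ is decidable. -/

import Mathlib

universe u v w

namespace RUNO

/-! ### Algebras of type `⟨∨, ∧, →, ', 0, 1⟩` -/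

/-- Operations of an algebra of type `⟨∨, ∧, →, ', 0, 1⟩`; no laws are assumed.
They are written `x ⊔ y`, `x ⊓ y`, `x ⇨ y`, `xᶜ`, `⊥`, `⊤`. The unary operation `'` (in the logical
language `∼`) is `ᶜ`; it is not the pseudocomplement, which is `star` below. -/
class Ops (A : Type u) extends Max A, Min A, HImp A, Compl A, Bot A, Top A

/-- `x* := x → 0`; on formulas this is the connective `¬`. -/
def star {A : Type u} [Ops A] (x : A) : A := x ⇨ ⊥

/-- `x →_H y := x → (x ∧ y)`. -/
def impH {A : Type u} [Ops A] (x y : A) : A := x ⇨ (x ⊓ y)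

/-- `x ↔_H y := (x →_H y) ∧ (y →_H x)`. -/
def iffH {A : Type u} [Ops A] (x y : A) : A := impH x y ⊓ impH y x

/-- Semi-Heyting algebras. -/
structure IsSemiHeyting (A : Type u) [Ops A] : Prop where
  sup_comm : ∀ x y : A, x ⊔ y = y ⊔ x
  inf_comm : ∀ x y : A, x ⊓ y = y ⊓ x
  sup_assoc : ∀ x y z : A, (x ⊔ y) ⊔ z = x ⊔ (y ⊔ z)
  inf_assoc : ∀ x y z : A, (x ⊓ y) ⊓ z = x ⊓ (y ⊓ z)
  sup_inf_self : ∀ x y : A, x ⊔ (x ⊓ y) = x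
  inf_sup_self : ∀ x y : A, x ⊓ (x ⊔ y) = x
  sup_bot : ∀ x : A, x ⊔ ⊥ = x
  inf_top : ∀ x : A, x ⊓ ⊤ = x
  inf_imp : ∀ x y : A, x ⊓ (x ⇨ y) = x ⊓ y
  inf_imp_inf : ∀ x y z : A, x ⊓ (y ⇨ z) = x ⊓ ((x ⊓ y) ⇨ (x ⊓ z))
  imp_self : ∀ x : A, x ⇨ x = ⊤

/-- Dually hemimorphic semi-Heyting algebras. -/
structure IsDHMSH (A : Type u) [Ops A] : Prop extends IsSemiHeyting A where
  bot_compl : (⊥ : A)ᶜ = ⊤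
  top_compl : (⊤ : A)ᶜ = ⊥
  inf_compl : ∀ x y : A, (x ⊓ y)ᶜ = xᶜ ⊔ yᶜ

/-- Dually quasi-De Morgan semi-Heyting algebras (`x ≤ y` stands for `x ∧ y = x`). -/
structure IsDQDSH (A : Type u) [Ops A] : Prop extends IsDHMSH A where
  sup_compl_compl : ∀ x y : A, (x ⊔ y)ᶜᶜ = xᶜᶜ ⊔ yᶜᶜ
  compl_compl_le : ∀ x : A, xᶜᶜ ⊓ x = xᶜᶜ

/-- De Morgan semi-Heyting algebras. -/
structure IsDMSH (A : Type u) [Ops A] : Prop extends IsDQDSH A where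
  compl_compl : ∀ x : A, xᶜᶜ = x

/-- Unorthodox De Morgan semi-Heyting algebras: `(0 → 1)' = 0 → 1`. -/
structure IsUNO (A : Type u) [Ops A] : Prop extends IsDMSH A where
  unorthodox : ((⊥ : A) ⇨ ⊤)ᶜ = ⊥ ⇨ ⊤

/-- Regular unos: `x ∧ x'*' ≤ y ∨ y*`. -/
structure IsRUNO (A : Type u) [Ops A] : Prop extends IsUNO A where
  regular : ∀ x y : A, (x ⊓ (star xᶜ)ᶜ) ⊓ (y ⊔ star y) = x ⊓ (star xᶜ)ᶜ

/-- Regular unos of level 1: `x ∧ x'* = (x ∧ x'*)'*`. -/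
structure IsRUNO1 (A : Type u) [Ops A] : Prop extends IsRUNO A where
  level_one : ∀ x : A, x ⊓ star xᶜ = star (x ⊓ star xᶜ)ᶜ

/-- A bundled algebra of type `⟨∨, ∧, →, ', 0, 1⟩`. -/
structure Alg : Type (u + 1) where
  carrier : Type u
  [ops : Ops carrier]

attribute [instance] Alg.ops

/-- The class of regular unorthodox algebras of level 1. -/
def RUNO1 : Set Alg.{u} := {A | IsRUNO1 A.carrier}

/-- Homomorphisms. -/
structure IsHom {A : Type u} {B : Type v} [Ops A] [Ops B] (f : A → B) : Prop where
  map_sup : ∀ x y, f (x ⊔ y) = f x ⊔ f y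
  map_inf : ∀ x y, f (x ⊓ y) = f x ⊓ f y
  map_imp : ∀ x y, f (x ⇨ y) = f x ⇨ f y
  map_compl : ∀ x, f xᶜ = (f x)ᶜ
  map_bot : f ⊥ = ⊥
  map_top : f ⊤ = ⊤

/-- The direct product of a family of algebras. -/
def Alg.pi {ι : Type u} (F : ι → Alg.{u}) : Alg.{u} where
  carrier := ∀ i, (F i).carrier
  ops :=
    { max := fun x y i => x i ⊔ y i
      min := fun x y i => x i ⊓ y i
      himp := fun x y i => x i ⇨ y i
      compl := fun x i => (x i)ᶜ
      bot := fun _ => ⊥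
      top := fun _ => ⊤ }

/-- A variety: a class closed under homomorphic images, subalgebras (up to isomorphism) and
arbitrary direct products, the empty one included. -/
structure IsVariety (K : Set Alg.{u}) : Prop where
  closed_image : ∀ A ∈ K, ∀ (B : Alg.{u}) (f : A.carrier → B.carrier),
    IsHom f → Function.Surjective f → B ∈ K
  closed_sub : ∀ B ∈ K, ∀ (A : Alg.{u}) (f : A.carrier → B.carrier),
    IsHom f → Function.Injective f → A ∈ K
  closed_pi : ∀ (ι : Type u) (F : ι → Alg.{u}), (∀ i, F i ∈ K) → Alg.pi F ∈ K

/-- `𝕍(K)`, the variety generated by `K`: the least variety that contains `K`. -/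
def varietyGen (K : Set Alg.{u}) : Set Alg.{u} :=
  {A | ∀ W : Set Alg.{u}, IsVariety W → K ⊆ W → A ∈ W}

/-- The nontrivial subvarieties of `RUNO1`: those with a member that has two distinct elements. -/
def nontrivialSubvarieties : Set (Set Alg.{u}) :=
  {W | IsVariety W ∧ W ⊆ RUNO1 ∧ ∃ A ∈ W, Nontrivial A.carrier}

/-! ### The five algebras -/

/-- The algebra on the chain `0 < 2 < 1` with `0' = 1`, `1' = 0`, `2' = 2` and the given
implication; the row of a table is the left argument. -/
def chainAlg (imp : Fin 3 → Fin 3 → Fin 3) : Alg.{0} where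
  carrier := Fin 3
  ops :=
    { max := ![![0, 1, 2], ![1, 1, 1], ![2, 1, 2]]
      min := ![![0, 0, 0], ![0, 1, 2], ![0, 2, 2]]
      himp := imp
      compl := ![1, 0, 2]
      bot := 0
      top := 1 }

def A1 : Alg.{0} := chainAlg ![![1, 2, 1], ![0, 1, 2], ![0, 1, 1]]

def A2 : Alg.{0} := chainAlg ![![1, 2, 1], ![0, 1, 2], ![0, 2, 1]]

def A3 : Alg.{0} := chainAlg ![![1, 2, 2], ![0, 1, 2], ![0, 1, 1]]

def A4 : Alg.{0} := chainAlg ![![1, 2, 2], ![0, 1, 2], ![0, 2, 1]]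

/-- The lattice reduct is the four-element Boolean lattice with atoms `2` and `3`. -/
def A5 : Alg.{0} where
  carrier := Fin 4
  ops :=
    { max := ![![0, 1, 2, 3], ![1, 1, 1, 1], ![2, 1, 2, 1], ![3, 1, 1, 3]]
      min := ![![0, 0, 0, 0], ![0, 1, 2, 3], ![0, 2, 2, 0], ![0, 3, 0, 3]]
      himp := ![![1, 2, 1, 2], ![0, 1, 2, 3], ![3, 2, 1, 0], ![2, 1, 2, 1]]
      compl := ![1, 0, 2, 3]
      bot := 0
      top := 1 }

/-- Labels of the five algebras. -/
inductive Label : Type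
  | a1 | a2 | a3 | a4 | a5

def Label.alg : Label → Alg.{0}
  | .a1 => A1
  | .a2 => A2
  | .a3 => A3
  | .a4 => A4
  | .a5 => A5

/-- The algebras (in an arbitrary universe) isomorphic to one of the five algebras with label
in `S`. -/
def copies (S : Set Label) : Set Alg.{u} :=
  {B | ∃ i ∈ S, ∃ f : i.alg.carrier → B.carrier, IsHom f ∧ Function.Bijective f}

/-- `𝕍({Ai : i ∈ S})`. -/
def V (S : Set Label) : Set Alg.{u} := varietyGen (copies S)

/-! ### Formulas -/

/-- Formulas in the language `⟨∨, ∧, →, ∼, ⊥, ⊤⟩` over countably many variables. -/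
inductive Fm : Type
  | bot : Fm
  | top : Fm
  | var : ℕ → Fm
  | neg : Fm → Fm
  | or : Fm → Fm → Fm
  | and : Fm → Fm → Fm
  | imp : Fm → Fm → Fm

/-- The formula algebra; `∼φ` is written `φᶜ`. -/
instance : Ops Fm where
  max := Fm.or
  min := Fm.and
  himp := Fm.imp
  compl := Fm.neg
  bot := Fm.bot
  top := Fm.top

/-- The value of a formula under the interpretation given by `h` on the variables. With
`A = Fm` this is substitution. -/
def Fm.eval {A : Type u} [Ops A] (h : ℕ → A) : Fm → A
  | .bot => ⊥
  | .top => ⊤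
  | .var n => h n
  | .neg φ => (φ.eval h)ᶜ
  | .or φ ψ => φ.eval h ⊔ ψ.eval h
  | .and φ ψ => φ.eval h ⊓ ψ.eval h
  | .imp φ ψ => φ.eval h ⇨ ψ.eval h

/-- Gödel numbering of formulas, used only to speak of computability. -/
def Fm.enc : Fm → ℕ
  | .bot => 0
  | .top => 1
  | .var n => 5 * n + 2
  | .neg φ => 5 * φ.enc + 1 + 2
  | .or φ ψ => 5 * Nat.pair φ.enc ψ.enc + 2 + 2
  | .and φ ψ => 5 * Nat.pair φ.enc ψ.enc + 3 + 2
  | .imp φ ψ => 5 * Nat.pair φ.enc ψ.enc + 4 + 2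

def Fm.dec : ℕ → Fm
  | 0 => .bot
  | 1 => .top
  | n + 2 =>
    have h0 : n / 5 < n + 2 := by omega
    have h1 : (n / 5).unpair.1 < n + 2 := lt_of_le_of_lt (Nat.unpair_left_le _) h0
    have h2 : (n / 5).unpair.2 < n + 2 := lt_of_le_of_lt (Nat.unpair_right_le _) h0
    match n % 5 with
    | 0 => .var (n / 5)
    | 1 => .neg (Fm.dec (n / 5))
    | 2 => .or (Fm.dec (n / 5).unpair.1) (Fm.dec (n / 5).unpair.2)
    | 3 => .and (Fm.dec (n / 5).unpair.1) (Fm.dec (n / 5).unpair.2)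
    | _ => .imp (Fm.dec (n / 5).unpair.1) (Fm.dec (n / 5).unpair.2)

theorem Fm.dec_enc (φ : Fm) : Fm.dec φ.enc = φ := by
  induction φ with
  | bot => simp [Fm.enc, Fm.dec]
  | top => simp [Fm.enc, Fm.dec]
  | var n => simp [Fm.enc, Fm.dec]
  | neg φ ih =>
    have h1 : (5 * φ.enc + 1) / 5 = φ.enc := by omega
    have h2 : (5 * φ.enc + 1) % 5 = 1 := by omega
    simp [Fm.enc, Fm.dec, h1, h2, ih]
  | or φ ψ ih1 ih2 =>
    have h1 : (5 * Nat.pair φ.enc ψ.enc + 2) / 5 = Nat.pair φ.enc ψ.enc := by omega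
    have h2 : (5 * Nat.pair φ.enc ψ.enc + 2) % 5 = 2 := by omega
    simp [Fm.enc, Fm.dec, h1, h2, ih1, ih2]
  | and φ ψ ih1 ih2 =>
    have h1 : (5 * Nat.pair φ.enc ψ.enc + 3) / 5 = Nat.pair φ.enc ψ.enc := by omega
    have h2 : (5 * Nat.pair φ.enc ψ.enc + 3) % 5 = 3 := by omega
    simp [Fm.enc, Fm.dec, h1, h2, ih1, ih2]
  | imp φ ψ ih1 ih2 =>
    have h1 : (5 * Nat.pair φ.enc ψ.enc + 4) / 5 = Nat.pair φ.enc ψ.enc := by omega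
    have h2 : (5 * Nat.pair φ.enc ψ.enc + 4) % 5 = 4 := by omega
    simp [Fm.enc, Fm.dec, h1, h2, ih1, ih2]

theorem Fm.enc_dec (n : ℕ) : (Fm.dec n).enc = n := by
  induction n using Nat.strong_induction_on with
  | _ n ih =>
    match n with
    | 0 => simp [Fm.enc, Fm.dec]
    | 1 => simp [Fm.enc, Fm.dec]
    | m + 2 =>
      have h0 : m / 5 < m + 2 := by omega
      have e0 := ih _ h0
      have e1 := ih _ (lt_of_le_of_lt (Nat.unpair_left_le (m / 5)) h0)
      have e2 := ih _ (lt_of_le_of_lt (Nat.unpair_right_le (m / 5)) h0)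
      have hm : m % 5 < 5 := Nat.mod_lt _ (by norm_num)
      rw [Fm.dec]
      have hc : m % 5 = 0 ∨ m % 5 = 1 ∨ m % 5 = 2 ∨ m % 5 = 3 ∨ m % 5 = 4 := by omega
      rcases hc with h | h | h | h | h <;> simp only [h, Fm.enc, e0, e1, e2, Nat.pair_unpair] <;>
        omega

instance : Denumerable Fm :=
  Denumerable.mk' ⟨Fm.enc, Fm.dec, Fm.dec_enc, Fm.enc_dec⟩

/-! ### Hilbert-style logics -/

/-- Derivability from `Γ` in the logic whose axioms are the substitution instances of the members
of `Ax`, and whose rules are semi-Modus Ponens and semi-Contraposition. -/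
inductive Deriv (Ax : Set Fm) (Γ : Set Fm) : Fm → Prop
  | hyp {φ : Fm} : φ ∈ Γ → Deriv Ax Γ φ
  | ax {φ : Fm} (σ : ℕ → Fm) : φ ∈ Ax → Deriv Ax Γ (φ.eval σ)
  | smp {φ ψ : Fm} : Deriv Ax Γ φ → Deriv Ax Γ (impH φ ψ) → Deriv Ax Γ ψ
  | scp {φ ψ : Fm} : Deriv Ax Γ (impH φ ψ) → Deriv Ax Γ (impH ψᶜ φᶜ)

/-- Three distinct variables, for axiom schemata. -/
def p : Fm := .var 0

def q : Fm := .var 1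

def r : Fm := .var 2

/-- The axioms of semi-Heyting logic. -/
def axSH : Set Fm :=
  { impH p (p ⊔ q),
    impH q (p ⊔ q),
    impH (impH p r) (impH (impH q r) (impH (p ⊔ q) r)),
    impH (p ⊓ q) p,
    impH (impH r p) (impH (impH r q) (impH r (p ⊓ q))),
    ⊤,
    impH ⊥ p,
    impH (impH (p ⊓ q) r) (impH p (impH q r)),
    impH (impH p (impH q r)) (impH (p ⊓ q) r),
    impH (impH p q) (impH (impH q p) (impH (p ⇨ r) (q ⇨ r))),
    impH (impH p q) (impH (impH q p) (impH (r ⇨ q) (r ⇨ p))) }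

/-- The De Morgan axioms. -/
def axDM : Set Fm :=
  { iffH ⊤ (⊥ : Fm)ᶜ,
    iffH (p ⊓ q)ᶜ (pᶜ ⊔ qᶜ),
    iffH (p ⊔ q)ᶜ (pᶜ ⊓ qᶜ),
    iffH pᶜᶜ p }

/-- The axioms of the logic `RUNO1`: those of De Morgan semi-Heyting logic, and unorthodoxy,
regularity and level 1. -/
def axRUNO1 : Set Fm :=
  axSH ∪ axDM ∪
  { iffH ((⊥ : Fm) ⇨ ⊤)ᶜ (⊥ ⇨ ⊤),
    iffH ((p ⊓ (star pᶜ)ᶜ) ⊔ (q ⊔ star q)) (q ⊔ star q),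
    iffH (star (p ⊓ star pᶜ)ᶜ) (p ⊓ star pᶜ) }

/-- The axiomatic extension of the logic `RUNO1` by the axioms in `E`. -/
def ext (E : List Fm) : Set Fm → Fm → Prop :=
  Deriv (axRUNO1 ∪ {φ | φ ∈ E})

/-- The relation `{ψ ≈ 1 : ψ ∈ Γ} ⊨_K φ ≈ 1`. -/
def conseq (K : Set Alg.{u}) (Γ : Set Fm) (φ : Fm) : Prop :=
  ∀ A ∈ K, ∀ h : ℕ → A.carrier, (∀ ψ ∈ Γ, ψ.eval h = ⊤) → φ.eval h = ⊤

/-- `L` is the logic of the class `K`: `K` is an equivalent algebraic semantics of `L`, with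
defining identity `x ≈ 1` and equivalence formulas `x →_H y`, `y →_H x`. -/
structure IsLogicOf (L : Set Fm → Fm → Prop) (K : Set Alg.{u}) : Prop where
  complete : ∀ (Γ : Set Fm) (φ : Fm), L Γ φ ↔ conseq K Γ φ
  equivalence : ∀ (φ ψ : Fm), ∀ A ∈ K, ∀ h : ℕ → A.carrier,
    φ.eval h = ψ.eval h ↔ (impH φ ψ).eval h = ⊤ ∧ (impH ψ φ).eval h = ⊤

/-- A logic is decidable if an algorithm decides, for a finite list `Γ` of premises and a formula
`φ`, whether `φ` is a consequence of `Γ`; for the empty list this is theoremhood. -/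
def IsDecidableLogic (L : Set Fm → Fm → Prop) : Prop :=
  ComputablePred fun x : List Fm × Fm => L {ψ | ψ ∈ x.1} x.2

/-! ### The bases -/

/-- `α := ⊥ → ⊤`. -/
def al : Fm := ⊥ ⇨ ⊤

/-- `β := ⊥ → α`. -/
def be : Fm := ⊥ ⇨ al

/-- `γ := ⊥ → β`. -/
def ga : Fm := ⊥ ⇨ be

/-- `¬α ↔_H ⊥`. -/
def e1 : Fm := iffH (star al) ⊥

/-- `β → ¬¬α ↔_H ¬¬α`. -/
def e2 : Fm := iffH (be ⇨ star (star al)) (star (star al))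

/-- `β ≥ α → ⊤`, that is, `(α → ⊤) →_H β`. -/
def e3 : Fm := impH (al ⇨ ⊤) be

/-- `¬α → (α → ⊤) ↔_H α`. -/
def e4 : Fm := iffH (star al ⇨ (al ⇨ ⊤)) al

/-- `(α → β) → α ↔_H β`. -/
def e5 : Fm := iffH ((al ⇨ be) ⇨ al) be

open Label in
/-- The 31 nonempty sets of algebras, each with the base (relative to `RUNO1`) of its logic. -/
def bases : List (Set Label × List Fm) :=
  [ ({a1}, [al ⇨ ⊤, be]),
    ({a2}, [be, iffH (al ⇨ ⊤) al, e1]),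
    ({a3}, [iffH (p ⇨ (p ⇨ (p ⇨ q))) (p ⇨ (p ⇨ q))]),
    ({a4}, [iffH (al ⇨ ⊤)ᶜ be]),
    ({a5}, [star al ⇨ ⊤]),
    ({a1, a2}, [e1, be]),
    ({a1, a3}, [e1, al ⇨ ⊤]),
    ({a1, a4}, [e1, iffH be (al ⇨ ⊤)]),
    ({a1, a5}, [e2, e3, e4]),
    ({a2, a3}, [e1, e2, e5]),
    ({a2, a4}, [e1, e3, e5]),
    ({a2, a5}, [iffH (al ⇨ be) al, e3, e5]),
    ({a3, a4}, [e1, iffH be al, e5]),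
    ({a3, a5}, [e2, e4, e5]),
    ({a4, a5}, [e3, e4, e5]),
    ({a1, a2, a3}, [e1, e2]),
    ({a1, a2, a4}, [e1, e3]),
    ({a1, a2, a5}, [e2, e3]),
    ({a1, a3, a4}, [e1, iffH ga al, e4]),
    ({a1, a3, a5}, [e4, e2]),
    ({a1, a4, a5}, [e3, e4]),
    ({a2, a3, a4}, [e1, e5]),
    ({a2, a3, a5}, [e2, e5]),
    ({a2, a4, a5}, [e3, e5]),
    ({a3, a4, a5}, [e4, e5]),
    ({a1, a2, a3, a4}, [e1]),
    ({a1, a2, a3, a5}, [e2]),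
    ({a1, a2, a4, a5}, [e3]),
    ({a1, a3, a4, a5}, [e4]),
    ({a2, a3, a4, a5}, [e5]),
    ({a1, a2, a3, a4, a5}, []) ]

end RUNO

namespace RUNO

/-! Everything follows from one structural fact, `exists_separating_hom`: any two distinct elements
of a member of `RUNO1` are separated by a homomorphism onto one of the five algebras.

To prove it, call `c` central if `c ⊓ cᶜ = ⊥`. Implication localizes below every element and `ᶜ`
localizes below central ones, so agreement below some central element outside a prime ideal is a
congruence. By level 1 every `x ⊓ star xᶜ` is central. For `a ≠ b`, a prime ideal containing `e ⊓
star eᶜ`, where `e = iffH a b`, gives a quotient that separates `a` from `b` and in which `x ⊓ star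
xᶜ = ⊥` for all `x ≠ ⊤` (`exists_simple_quotient`). In such a quotient regularity forces `xᶜ = x`
for every `x` other than `⊥` and `⊤`; since `ᶜ` reverses order, these elements form an antichain.
Unorthodoxy puts `⊥ ⇨ ⊤` among them. If it is the only one, the algebra is a three-element chain
with two free entries in its table, hence `A1`, ..., `A4`; if there is another, the lattice is the
four-element Boolean one, localization fixes the whole table, and the algebra is `A5`
(`IsSimple.exists_label`).

Hence a subvariety is determined by the labels of the five algebras it contains
(`IsVariety.eq_V_labels`), and consequence over it is consequence over those algebras
(`IsVariety.conseq_iff`). A finite check shows that each base is valid in exactly the algebras it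
should be; this also yields that different sets of labels generate different varieties. Completeness
comes from separating a non-theorem from `⊤` in the Lindenbaum–Tarski algebra (`exists_lindenbaum`),
decidability from primitive recursive evaluation in finite algebras. -/

/-! ### Finite checks on the five algebras and the 31 bases. -/

def Label.toNat : Label → ℕ
  | .a1 => 1
  | .a2 => 2
  | .a3 => 3
  | .a4 => 4
  | .a5 => 5

theorem Label.toNat_injective : Function.Injective Label.toNat := by
  intro a b h
  cases a <;> cases b <;> first | rfl | (simp [Label.toNat] at h)

instance : DecidableEq Label := Label.toNat_injective.decidableEq

def Label.all : Finset Label := {.a1, .a2, .a3, .a4, .a5}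

instance : Fintype Label := ⟨Label.all, by intro x; cases x <;> decide⟩

instance (i : Label) : DecidableEq i.alg.carrier :=
  match i with
  | .a1 => inferInstanceAs (DecidableEq (Fin 3))
  | .a2 => inferInstanceAs (DecidableEq (Fin 3))
  | .a3 => inferInstanceAs (DecidableEq (Fin 3))
  | .a4 => inferInstanceAs (DecidableEq (Fin 3))
  | .a5 => inferInstanceAs (DecidableEq (Fin 4))

instance (i : Label) : Fintype i.alg.carrier :=
  match i with
  | .a1 => inferInstanceAs (Fintype (Fin 3))
  | .a2 => inferInstanceAs (Fintype (Fin 3))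
  | .a3 => inferInstanceAs (Fintype (Fin 3))
  | .a4 => inferInstanceAs (Fintype (Fin 3))
  | .a5 => inferInstanceAs (Fintype (Fin 4))

/-- The assignment `p ↦ x`, `q ↦ y`, all other variables to `z`. -/
def assign {A : Type u} (x y z : A) : ℕ → A
  | 0 => x
  | 1 => y
  | _ => z

/-- A strict upper bound of the variables of a formula. -/
def Fm.bound : Fm → ℕ
  | .bot => 0
  | .top => 0
  | .var n => n + 1
  | .neg φ => φ.bound
  | .or φ ψ => max φ.bound ψ.bound
  | .and φ ψ => max φ.bound ψ.bound
  | .imp φ ψ => max φ.bound ψ.bound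

theorem Fm.eval_congr {A : Type u} [Ops A] {h k : ℕ → A} (φ : Fm)
    (H : ∀ n < φ.bound, h n = k n) : φ.eval h = φ.eval k := by
  induction φ with
  | bot => rfl
  | top => rfl
  | var n => exact H n (Nat.lt_succ_self n)
  | neg φ ih => simp only [Fm.eval]; rw [ih H]
  | or φ ψ ih1 ih2 =>
    simp only [Fm.eval]
    rw [ih1 fun n hn => H n (lt_max_of_lt_left hn), ih2 fun n hn => H n (lt_max_of_lt_right hn)]
  | and φ ψ ih1 ih2 =>
    simp only [Fm.eval]
    rw [ih1 fun n hn => H n (lt_max_of_lt_left hn), ih2 fun n hn => H n (lt_max_of_lt_right hn)]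
  | imp φ ψ ih1 ih2 =>
    simp only [Fm.eval]
    rw [ih1 fun n hn => H n (lt_max_of_lt_left hn), ih2 fun n hn => H n (lt_max_of_lt_right hn)]

/-- Validity of `φ ≈ 1`. -/
def Valid (A : Type u) [Ops A] (φ : Fm) : Prop := ∀ h : ℕ → A, φ.eval h = ⊤

/-- Only the first three variables can matter, so over a finite algebra the right side is a finite
check. -/
theorem valid_iff_assign {A : Type u} [Ops A] {φ : Fm} (hφ : φ.bound ≤ 3) :
    Valid A φ ↔ ∀ x y z : A, φ.eval (assign x y z) = ⊤ := by
  refine ⟨fun H x y z => H _, fun H h => ?_⟩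
  rw [← H (h 0) (h 1) (h 2)]
  refine Fm.eval_congr φ fun n hn => ?_
  have : n < 3 := lt_of_lt_of_le hn hφ
  interval_cases n <;> rfl

/-- `RUNO.bases`, with finsets of labels. -/
def finBases : List (Finset Label × List Fm) :=
  [ ({.a1}, [al ⇨ ⊤, be]),
    ({.a2}, [be, iffH (al ⇨ ⊤) al, e1]),
    ({.a3}, [iffH (p ⇨ (p ⇨ (p ⇨ q))) (p ⇨ (p ⇨ q))]),
    ({.a4}, [iffH (al ⇨ ⊤)ᶜ be]),
    ({.a5}, [star al ⇨ ⊤]),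
    ({.a1, .a2}, [e1, be]),
    ({.a1, .a3}, [e1, al ⇨ ⊤]),
    ({.a1, .a4}, [e1, iffH be (al ⇨ ⊤)]),
    ({.a1, .a5}, [e2, e3, e4]),
    ({.a2, .a3}, [e1, e2, e5]),
    ({.a2, .a4}, [e1, e3, e5]),
    ({.a2, .a5}, [iffH (al ⇨ be) al, e3, e5]),
    ({.a3, .a4}, [e1, iffH be al, e5]),
    ({.a3, .a5}, [e2, e4, e5]),
    ({.a4, .a5}, [e3, e4, e5]),
    ({.a1, .a2, .a3}, [e1, e2]),
    ({.a1, .a2, .a4}, [e1, e3]),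
    ({.a1, .a2, .a5}, [e2, e3]),
    ({.a1, .a3, .a4}, [e1, iffH ga al, e4]),
    ({.a1, .a3, .a5}, [e4, e2]),
    ({.a1, .a4, .a5}, [e3, e4]),
    ({.a2, .a3, .a4}, [e1, e5]),
    ({.a2, .a3, .a5}, [e2, e5]),
    ({.a2, .a4, .a5}, [e3, e5]),
    ({.a3, .a4, .a5}, [e4, e5]),
    ({.a1, .a2, .a3, .a4}, [e1]),
    ({.a1, .a2, .a3, .a5}, [e2]),
    ({.a1, .a2, .a4, .a5}, [e3]),
    ({.a1, .a3, .a4, .a5}, [e4]),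
    ({.a2, .a3, .a4, .a5}, [e5]),
    ({.a1, .a2, .a3, .a4, .a5}, []) ]

theorem bases_eq_map : bases = finBases.map fun b => ((b.1 : Set Label), b.2) := by
  simp [bases, finBases]

theorem finBases_bound : ∀ b ∈ finBases, ∀ φ ∈ b.2, φ.bound ≤ 3 := by decide +kernel

/-- The computational core: it is used both for axiomatizing the varieties and for telling them
apart. -/
theorem finBases_table : ∀ b ∈ finBases, ∀ i : Label,
    (∀ φ ∈ b.2, ∀ x y z : i.alg.carrier, φ.eval (assign x y z) = ⊤) ↔ i ∈ b.1 := by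
  decide +kernel

theorem finBases_nodup : (finBases.map Prod.fst).Nodup := by decide +kernel

theorem finBases_complete : ∀ S : Finset Label, S.Nonempty → S ∈ finBases.map Prod.fst := by
  decide +kernel

/-! ### Homomorphisms, identities and model classes. -/

theorem IsHom.map_eval {A : Type u} {B : Type v} [Ops A] [Ops B] {f : A → B} (hf : IsHom f)
    (h : ℕ → A) (φ : Fm) : f (φ.eval h) = φ.eval fun n => f (h n) := by
  induction φ with
  | bot => exact hf.map_bot
  | top => exact hf.map_top
  | var n => rfl
  | neg φ ih => simp only [Fm.eval, hf.map_compl, ih]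
  | or φ ψ ih1 ih2 => simp only [Fm.eval, hf.map_sup, ih1, ih2]
  | and φ ψ ih1 ih2 => simp only [Fm.eval, hf.map_inf, ih1, ih2]
  | imp φ ψ ih1 ih2 => simp only [Fm.eval, hf.map_imp, ih1, ih2]

theorem IsHom.comp {A : Type u} {B : Type v} {C : Type w} [Ops A] [Ops B] [Ops C]
    {g : B → C} {f : A → B} (hg : IsHom g) (hf : IsHom f) : IsHom fun x => g (f x) where
  map_sup x y := by rw [hf.map_sup, hg.map_sup]
  map_inf x y := by rw [hf.map_inf, hg.map_inf]
  map_imp x y := by rw [hf.map_imp, hg.map_imp]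
  map_compl x := by rw [hf.map_compl, hg.map_compl]
  map_bot := by rw [hf.map_bot, hg.map_bot]
  map_top := by rw [hf.map_top, hg.map_top]

theorem IsHom.inverse {A : Type u} {B : Type v} [Ops A] [Ops B] {f : A → B} (hf : IsHom f)
    (hbij : Function.Bijective f) :
    ∃ g : B → A, IsHom g ∧ Function.Bijective g := by
  let e := Equiv.ofBijective f hbij
  have he : ∀ x, e x = f x := fun x => rfl
  refine ⟨e.symm, ?_, e.symm.bijective⟩
  constructor <;> intros <;> rw [Equiv.symm_apply_eq] <;>
    simp [he, hf.map_sup, hf.map_inf, hf.map_imp, hf.map_compl, hf.map_bot, hf.map_top] <;>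
    simp [← he]

theorem Alg.isHom_proj {ι : Type u} (F : ι → Alg.{u}) (i : ι) :
    IsHom fun x : (Alg.pi F).carrier => (x i : (F i).carrier) :=
  ⟨fun _ _ => rfl, fun _ _ => rfl, fun _ _ => rfl, fun _ => rfl, rfl, rfl⟩

/-- The algebra `A` satisfies the identities in `T`. -/
def Models (A : Type u) [Ops A] (T : List (Fm × Fm)) : Prop :=
  ∀ e ∈ T, ∀ h : ℕ → A, e.1.eval h = e.2.eval h

theorem Models.of_surjective {A : Type u} {B : Type v} [Ops A] [Ops B] {T : List (Fm × Fm)}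
    (H : Models A T) {f : A → B} (hf : IsHom f) (hs : Function.Surjective f) : Models B T := by
  intro e he h
  choose k hk using fun n => hs (h n)
  have := congrArg f (H e he k)
  simpa only [hf.map_eval, hk] using this

theorem Models.of_injective {A : Type u} {B : Type v} [Ops A] [Ops B] {T : List (Fm × Fm)}
    (H : Models B T) {f : A → B} (hf : IsHom f) (hi : Function.Injective f) : Models A T := by
  intro e he h
  apply hi
  simpa only [hf.map_eval] using H e he fun n => f (h n)

theorem isVariety_models (T : List (Fm × Fm)) : IsVariety {A : Alg.{u} | Models A.carrier T} where
  closed_image _ hA _ _ hf hs := Models.of_surjective hA hf hs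
  closed_sub _ hB _ _ hf hi := Models.of_injective hB hf hi
  closed_pi _ F hF := by
    intro e he h
    funext i
    rw [(Alg.isHom_proj F i).map_eval h e.1, (Alg.isHom_proj F i).map_eval h e.2]
    exact hF i e he _

/-- Identities defining the class `RUNO1`. -/
def identities : List (Fm × Fm) :=
  [ (p ⊔ q, q ⊔ p), (p ⊓ q, q ⊓ p), ((p ⊔ q) ⊔ r, p ⊔ (q ⊔ r)), ((p ⊓ q) ⊓ r, p ⊓ (q ⊓ r)),
    (p ⊔ (p ⊓ q), p), (p ⊓ (p ⊔ q), p), (p ⊔ ⊥, p), (p ⊓ ⊤, p), (p ⊓ (p ⇨ q), p ⊓ q),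
    (p ⊓ (q ⇨ r), p ⊓ ((p ⊓ q) ⇨ (p ⊓ r))), (p ⇨ p, ⊤),
    ((⊥ : Fm)ᶜ, ⊤), ((⊤ : Fm)ᶜ, ⊥), ((p ⊓ q)ᶜ, pᶜ ⊔ qᶜ),
    ((p ⊔ q)ᶜᶜ, pᶜᶜ ⊔ qᶜᶜ), (pᶜᶜ ⊓ p, pᶜᶜ), (pᶜᶜ, p), (((⊥ : Fm) ⇨ ⊤)ᶜ, ⊥ ⇨ ⊤),
    ((p ⊓ (star pᶜ)ᶜ) ⊓ (q ⊔ star q), p ⊓ (star pᶜ)ᶜ),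
    (p ⊓ star pᶜ, star (p ⊓ star pᶜ)ᶜ) ]

/-- The equational form transfers along surjections, embeddings and products, and can be checked by
evaluation. -/
theorem isRUNO1_iff {A : Type u} [Ops A] : IsRUNO1 A ↔ Models A identities := by
  simp only [Models, identities, List.forall_mem_cons]
  constructor
  · intro H
    exact ⟨fun h => H.sup_comm _ _, fun h => H.inf_comm _ _, fun h => H.sup_assoc _ _ _,
      fun h => H.inf_assoc _ _ _, fun h => H.sup_inf_self _ _, fun h => H.inf_sup_self _ _,
      fun h => H.sup_bot _, fun h => H.inf_top _, fun h => H.inf_imp _ _,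
      fun h => H.inf_imp_inf _ _ _, fun h => H.imp_self _, fun h => H.bot_compl,
      fun h => H.top_compl, fun h => H.inf_compl _ _, fun h => H.sup_compl_compl _ _,
      fun h => H.compl_compl_le _, fun h => H.compl_compl _, fun h => H.unorthodox,
      fun h => H.regular _ _, fun h => H.level_one _, by simp⟩
  · rintro ⟨h1, h2, h3, h4, h5, h6, h7, h8, h9, h10, h11, h12, h13, h14, h15, h16, h17, h18, h19,
      h20, -⟩
    exact
      { sup_comm := fun x y => h1 (assign x y x)
        inf_comm := fun x y => h2 (assign x y x)
        sup_assoc := fun x y z => h3 (assign x y z)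
        inf_assoc := fun x y z => h4 (assign x y z)
        sup_inf_self := fun x y => h5 (assign x y x)
        inf_sup_self := fun x y => h6 (assign x y x)
        sup_bot := fun x => h7 (assign x x x)
        inf_top := fun x => h8 (assign x x x)
        inf_imp := fun x y => h9 (assign x y x)
        inf_imp_inf := fun x y z => h10 (assign x y z)
        imp_self := fun x => h11 (assign x x x)
        bot_compl := h12 fun _ => ⊥
        top_compl := h13 fun _ => ⊥
        inf_compl := fun x y => h14 (assign x y x)
        sup_compl_compl := fun x y => h15 (assign x y x)
        compl_compl_le := fun x => h16 (assign x x x)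
        compl_compl := fun x => h17 (assign x x x)
        unorthodox := h18 fun _ => ⊥
        regular := fun x y => h19 (assign x y x)
        level_one := fun x => h20 (assign x x x) }

theorem models_label (i : Label) : Models i.alg.carrier identities := by
  have H : ∀ i : Label, ∀ e ∈ identities, ∀ x y z : i.alg.carrier,
      e.1.eval (assign x y z) = e.2.eval (assign x y z) := by decide +kernel
  have hb : ∀ e ∈ identities, e.1.bound ≤ 3 ∧ e.2.bound ≤ 3 := by decide +kernel
  intro e he h
  have key : ∀ φ : Fm, φ.bound ≤ 3 → φ.eval h = φ.eval (assign (h 0) (h 1) (h 2)) := by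
    intro φ hφ
    refine Fm.eval_congr φ fun n hn => ?_
    have : n < 3 := lt_of_lt_of_le hn hφ
    interval_cases n <;> rfl
  rw [key _ (hb e he).1, key _ (hb e he).2]
  exact H i e he _ _ _

/-- The members of `RUNO1` in which the formulas in `E` are valid. -/
def modelClass (E : List Fm) : Set Alg.{u} :=
  {A | IsRUNO1 A.carrier ∧ ∀ φ ∈ E, Valid A.carrier φ}

theorem isVariety_modelClass (E : List Fm) : IsVariety (modelClass.{u} E) := by
  have : modelClass.{u} E = {A | Models A.carrier (identities ++ E.map fun φ => (φ, ⊤))} := by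
    ext A
    simp only [modelClass, Set.mem_ofPred_eq, isRUNO1_iff, Models, List.mem_append, List.mem_map,
      or_imp, forall_and, Valid, forall_exists_index, and_imp]
    refine and_congr Iff.rfl ⟨?_, ?_⟩
    · rintro H _ φ hφ rfl h
      exact H φ hφ h
    · intro H φ hφ h
      exact H _ φ hφ rfl h
  rw [this]
  exact isVariety_models _

theorem IsRUNO1.of_surjective {A : Type u} {B : Type v} [Ops A] [Ops B] (H : IsRUNO1 A)
    {f : A → B} (hf : IsHom f) (hs : Function.Surjective f) : IsRUNO1 B :=
  isRUNO1_iff.2 ((isRUNO1_iff.1 H).of_surjective hf hs)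

theorem isRUNO1_label (i : Label) : IsRUNO1 i.alg.carrier := isRUNO1_iff.2 (models_label i)

/-- The lattice reduct of a semi-Heyting algebra. -/
@[reducible]
def IsSemiHeyting.lattice {A : Type u} [Ops A] (H : IsSemiHeyting A) : Lattice A :=
  Lattice.mk' H.sup_comm H.sup_assoc H.inf_comm H.inf_assoc H.sup_inf_self H.inf_sup_self

/-! ### Arithmetic of semi-Heyting algebras. -/

section SemiHeyting

variable {A : Type u} [Ops A] [hA : Fact (IsSemiHeyting A)]

instance (priority := 50) : Lattice A := hA.out.lattice

theorem le_top' (x : A) : x ≤ ⊤ := inf_eq_left.1 (hA.out.inf_top x)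

theorem bot_le' (x : A) : ⊥ ≤ x := sup_eq_left.1 (hA.out.sup_bot x)

theorem inf_imp_inf (x y z : A) : x ⊓ (y ⇨ z) = x ⊓ ((x ⊓ y) ⇨ (x ⊓ z)) :=
  hA.out.inf_imp_inf x y z

/-- Residuation: `impH` is a Heyting implication on the lattice reduct. One direction is `inf_imp`;
the other localizes `y ⇨ (y ⊓ z)` at `x`, where it becomes an instance of `imp_self`. -/
theorem le_impH {x y z : A} : x ≤ impH y z ↔ x ⊓ y ≤ z := by
  unfold impH
  constructor
  · intro h
    have h1 : y ⊓ (y ⇨ (y ⊓ z)) = y ⊓ (y ⊓ z) := hA.out.inf_imp _ _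
    calc x ⊓ y ≤ y ⊓ (y ⇨ (y ⊓ z)) := le_inf inf_le_right (inf_le_left.trans h)
      _ = y ⊓ (y ⊓ z) := h1
      _ ≤ z := inf_le_right.trans inf_le_right
  · intro h
    have h1 := inf_imp_inf x y (y ⊓ z)
    rw [show x ⊓ (y ⊓ z) = x ⊓ y by rw [← inf_assoc]; exact inf_eq_left.2 h,
      hA.out.imp_self, hA.out.inf_top] at h1
    exact inf_eq_left.1 h1

/-- Meets have a right adjoint, hence distribute over joins. -/
instance (priority := 60) : DistribLattice A :=
  { (inferInstance : Lattice A) with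
    le_sup_inf := by
      intro x y z
      refine le_impH.1 (sup_le (le_impH.2 (inf_le_left.trans le_sup_left)) (le_impH.2 ?_))
      rw [inf_comm]
      refine le_impH.1 (sup_le (le_impH.2 (inf_le_left.trans le_sup_left)) (le_impH.2 ?_))
      rw [inf_comm]
      exact le_sup_right }

theorem eq_top_of_le {x : A} (h : ⊤ ≤ x) : x = ⊤ := le_antisymm (le_top' x) h

theorem eq_bot_of_le {x : A} (h : x ≤ ⊥) : x = ⊥ := le_antisymm h (bot_le' x)

theorem top_inf (x : A) : ⊤ ⊓ x = x := inf_eq_right.2 (le_top' x)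

theorem inf_top (x : A) : x ⊓ ⊤ = x := inf_eq_left.2 (le_top' x)

theorem bot_inf (x : A) : ⊥ ⊓ x = ⊥ := inf_eq_left.2 (bot_le' x)

theorem inf_bot (x : A) : x ⊓ ⊥ = ⊥ := inf_eq_right.2 (bot_le' x)

theorem bot_sup (x : A) : ⊥ ⊔ x = x := sup_eq_right.2 (bot_le' x)

theorem sup_bot (x : A) : x ⊔ ⊥ = x := sup_eq_left.2 (bot_le' x)

theorem top_sup (x : A) : ⊤ ⊔ x = ⊤ := sup_eq_left.2 (le_top' x)

theorem sup_top (x : A) : x ⊔ ⊤ = ⊤ := sup_eq_right.2 (le_top' x)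

theorem inf_imp (x y : A) : x ⊓ (x ⇨ y) = x ⊓ y := hA.out.inf_imp x y

theorem imp_self (x : A) : x ⇨ x = ⊤ := hA.out.imp_self x

theorem top_imp (x : A) : ⊤ ⇨ x = x := by
  have := inf_imp ⊤ x
  rwa [top_inf, top_inf] at this

theorem impH_eq_top {x y : A} : impH x y = ⊤ ↔ x ≤ y := by
  rw [← top_inf x, ← le_impH, top_inf]
  exact ⟨fun h => h.ge, eq_top_of_le⟩

theorem star_eq_impH (x : A) : star x = impH x ⊥ := by
  unfold star impH
  rw [inf_bot]

theorem le_star {x y : A} : x ≤ star y ↔ x ⊓ y = ⊥ := by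
  rw [star_eq_impH, le_impH]
  exact ⟨eq_bot_of_le, fun h => h.le⟩

theorem inf_star (x : A) : x ⊓ star x = ⊥ := by
  rw [inf_comm]
  exact le_star.1 le_rfl

theorem eq_iff_impH {x y : A} : x = y ↔ impH x y = ⊤ ∧ impH y x = ⊤ := by
  rw [impH_eq_top, impH_eq_top]
  exact le_antisymm_iff

/-- Thus `iffH x y` is the largest element below which `x` and `y` agree. -/
theorem le_iffH {x y z : A} : z ≤ iffH x y ↔ z ⊓ x = z ⊓ y := by
  unfold iffH
  rw [le_inf_iff, le_impH, le_impH]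
  constructor
  · rintro ⟨h1, h2⟩
    exact le_antisymm (le_inf inf_le_left h1) (le_inf inf_le_left h2)
  · intro h
    exact ⟨h.le.trans inf_le_right, h.ge.trans inf_le_right⟩

end SemiHeyting

/-! ### Central elements and separating quotients. -/

section Level1

variable {A : Type u} [Ops A] [hR : Fact (IsRUNO1 A)]

instance : Fact (IsSemiHeyting A) :=
  ⟨hR.out.toIsSemiHeyting⟩

theorem bot_compl : (⊥ : A)ᶜ = ⊤ := hR.out.bot_compl

theorem top_compl : (⊤ : A)ᶜ = ⊥ := hR.out.top_compl

theorem compl_compl_eq (x : A) : xᶜᶜ = x := hR.out.compl_compl x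

theorem inf_compl (x y : A) : (x ⊓ y)ᶜ = xᶜ ⊔ yᶜ := hR.out.inf_compl x y

theorem compl_le {x y : A} (h : x ≤ y) : yᶜ ≤ xᶜ := by
  rw [← inf_eq_left.2 h, inf_compl]
  exact le_sup_right

theorem central_compl {c : A} (hc : c ⊓ cᶜ = ⊥) : c ⊔ cᶜ = ⊤ := by
  rw [← bot_compl, ← hc, inf_compl, compl_compl_eq, sup_comm]

/-- Level 1 says that `k = x ⊓ star xᶜ` equals `star kᶜ`, and `star kᶜ` is disjoint from `kᶜ`. -/
theorem central_level (x : A) : (x ⊓ star xᶜ) ⊓ (x ⊓ star xᶜ)ᶜ = ⊥ := by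
  rw [inf_comm]
  conv_lhs => rw [hR.out.level_one x]
  have := inf_star (x ⊓ star xᶜ)ᶜ
  rwa [← hR.out.level_one x] at this ⊢

/-- Congruence modulo a prime ideal of central elements: `x` and `y` agree below a central element
outside `I`. -/
def centralRel (I : Order.Ideal A) (x y : A) : Prop :=
  ∃ c, c ⊓ cᶜ = ⊥ ∧ c ∉ I ∧ c ⊓ x = c ⊓ y

theorem central_inf {c d : A} (hc : c ⊓ cᶜ = ⊥) (hd : d ⊓ dᶜ = ⊥) :
    (c ⊓ d) ⊓ (c ⊓ d)ᶜ = ⊥ := by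
  rw [inf_compl, inf_sup_left, inf_right_comm, hc, inf_assoc c d, hd, bot_inf, inf_bot, sup_bot]

theorem centralRel_mono {c d x y : A} (h : c ≤ d) (hd : d ⊓ x = d ⊓ y) : c ⊓ x = c ⊓ y := by
  rw [← inf_eq_left.2 h, inf_assoc, hd, inf_assoc]

theorem inf_himp_congr {c x y z w : A} (h1 : c ⊓ x = c ⊓ y) (h2 : c ⊓ z = c ⊓ w) :
    c ⊓ (x ⇨ z) = c ⊓ (y ⇨ w) := by
  rw [inf_imp_inf, h1, h2, ← inf_imp_inf]

/-- Centrality removes the extra term: `c ⊓ (c ⊓ x)ᶜ = (c ⊓ cᶜ) ⊔ (c ⊓ xᶜ) = c ⊓ xᶜ`. -/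
theorem inf_compl_congr {c x y : A} (hc : c ⊓ cᶜ = ⊥) (h : c ⊓ x = c ⊓ y) :
    c ⊓ xᶜ = c ⊓ yᶜ := by
  have := congrArg (fun z => c ⊓ zᶜ) h
  simpa only [inf_compl, inf_sup_left, hc, bot_sup] using this

/-- The element `d` below bounds every central element below which `a` and `b` agree, so a prime
ideal containing `d` leaves no witness identifying them. Primality also sends each central element
to `⊥` or `⊤`. -/
theorem exists_simple_quotient {a b : A} (hab : a ≠ b) :
    ∃ (Q : Type u) (_ : Ops Q) (f : A → Q), IsHom f ∧ Function.Surjective f ∧ f a ≠ f b ∧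
      ∀ x : Q, x ≠ ⊤ → x ⊓ star xᶜ = ⊥ := by
  set e := iffH a b with he
  set d := e ⊓ star eᶜ with hd
  have hdtop : ¬ ⊤ ≤ d := by
    intro h
    have : ⊤ ≤ iffH a b := h.trans inf_le_left
    rw [le_iffH, top_inf, top_inf] at this
    exact hab this
  obtain ⟨I, hI, hdI, hdisj⟩ := DistribLattice.prime_ideal_of_disjoint_filter_ideal
    (F := Order.PFilter.principal (⊤ : A)) (I := Order.Ideal.principal d) (by
      rw [Set.disjoint_left]
      intro x hx hx'
      exact hdtop (le_trans hx hx'))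
  have hdI : d ∈ I := hdI (le_refl d)
  have htop : (⊤ : A) ∉ I := fun h => Set.disjoint_left.1 hdisj (le_refl (⊤ : A)) h
  have hinf : ∀ {c d : A}, c ∉ I → d ∉ I → c ⊓ d ∉ I := fun hc hd h =>
    (hI.mem_or_mem h).elim hc hd
  let s : Setoid A :=
    { r := centralRel I
      iseqv :=
        { refl := fun x => ⟨⊤, by rw [top_inf, top_compl], htop, rfl⟩
          symm := fun ⟨c, h1, h2, h3⟩ => ⟨c, h1, h2, h3.symm⟩
          trans := fun ⟨c, h1, h2, h3⟩ ⟨d, k1, k2, k3⟩ =>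
            ⟨c ⊓ d, central_inf h1 k1, hinf h2 k2,
              (centralRel_mono inf_le_left h3).trans (centralRel_mono inf_le_right k3)⟩ } }
  have two : ∀ {op : A → A → A}, (∀ c x y z w : A, c ⊓ x = c ⊓ y → c ⊓ z = c ⊓ w →
      c ⊓ op x z = c ⊓ op y w) → ∀ x y, x ≈ y → ∀ z w, z ≈ w → op x z ≈ op y w := by
    rintro op hop x y ⟨c, h1, h2, h3⟩ z w ⟨d, k1, k2, k3⟩
    exact ⟨c ⊓ d, central_inf h1 k1, hinf h2 k2,
      hop _ _ _ _ _ (centralRel_mono inf_le_left h3) (centralRel_mono inf_le_right k3)⟩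
  let ops : Ops (Quotient s) :=
    { max := Quotient.map₂ (· ⊔ ·) (two fun c x y z w h1 h2 => by
        rw [inf_sup_left, inf_sup_left, h1, h2])
      min := Quotient.map₂ (· ⊓ ·) (two fun c x y z w h1 h2 => by
        rw [inf_inf_distrib_left, inf_inf_distrib_left c y, h1, h2])
      himp := Quotient.map₂ (· ⇨ ·) (two fun c x y z w h1 h2 => inf_himp_congr h1 h2)
      compl := Quotient.map (·ᶜ) (fun x y ⟨c, h1, h2, h3⟩ => ⟨c, h1, h2, inf_compl_congr h1 h3⟩)
      bot := ⟦⊥⟧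
      top := ⟦⊤⟧ }
  refine ⟨Quotient s, ops, fun x => ⟦x⟧,
    ⟨fun _ _ => rfl, fun _ _ => rfl, fun _ _ => rfl, fun _ => rfl, rfl, rfl⟩,
    Quotient.mk_surjective, ?_, ?_⟩
  · intro h
    obtain ⟨c, h1, h2, h3⟩ := Quotient.exact h
    -- From `c ≤ e` comes `c ⊓ eᶜ ≤ c ⊓ cᶜ = ⊥`, hence `c ≤ star eᶜ`; so `c ≤ d`, against `c ∉ I`.
    have hce : c ≤ e := le_iffH.2 h3
    refine h2 (I.lower (le_inf hce ?_) hdI)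
    exact le_star.2 (eq_bot_of_le ((inf_le_inf_left c (compl_le hce)).trans h1.le))
  · intro x
    induction x using Quotient.inductionOn with
    | h y =>
    intro hy
    have hc := central_level y
    set k := y ⊓ star yᶜ with hk
    -- If `k` were outside `I` it would witness that `y` is identified with `⊤`, because `k ≤ y`.
    have hkI : k ∈ I := by
      by_contra h
      refine hy (Quotient.sound ⟨k, hc, h, ?_⟩)
      rw [inf_top]
      exact inf_eq_left.2 inf_le_left
    -- The witness `kᶜ` is central and lies outside `I`, since `k ∈ I` and `k ⊔ kᶜ = ⊤`.
    refine Quotient.sound ⟨kᶜ, ?_, fun h => htop ?_, ?_⟩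
    · rwa [compl_compl_eq, inf_comm]
    · rw [← central_compl hc]
      exact I.sup_mem hkI h
    · rw [inf_bot, inf_comm]
      exact hc

end Level1
-- Classification of the simple algebras.
section Simple

variable {Q : Type u} [Ops Q] [hR : Fact (IsRUNO1 Q)]

/-- `Q` is a simple member of `RUNO1`. -/
structure IsSimple (Q : Type u) [Ops Q] : Prop where
  bot_ne_top : (⊥ : Q) ≠ ⊤
  inf_star_compl : ∀ x : Q, x ≠ ⊤ → x ⊓ star xᶜ = ⊥

theorem compl_ne_top {x : Q} (h : x ≠ ⊥) : xᶜ ≠ ⊤ := by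
  intro h'
  rw [← compl_compl_eq x, h', top_compl] at h
  exact h rfl

theorem compl_ne_bot {x : Q} (h : x ≠ ⊤) : xᶜ ≠ ⊥ := by
  intro h'
  rw [← compl_compl_eq x, h', bot_compl] at h
  exact h rfl

/-- Simplicity applied to `x` gives one inequality, applied to `xᶜ` the other. -/
theorem IsSimple.star_compl (hs : IsSimple Q) {x : Q} (h0 : x ≠ ⊥) (h1 : x ≠ ⊤) :
    star xᶜ = star x := by
  apply le_antisymm
  · rw [le_star, inf_comm]
    exact hs.inf_star_compl x h1
  · rw [le_star, inf_comm]
    simpa only [compl_compl_eq] using hs.inf_star_compl xᶜ (compl_ne_top h0)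

/-- This is where regularity enters. Since `y ⊔ (star x)ᶜ = ⊤`, the element `x` splits into `x ⊓ y`
and `x ⊓ (star x)ᶜ`; regularity puts the second part below `y ⊔ star y`, and `star y = star x` is
disjoint from `x`. -/
theorem IsSimple.le_of_star_eq (hs : IsSimple Q) {x y : Q} (hx0 : x ≠ ⊥) (hx1 : x ≠ ⊤)
    (hy0 : y ≠ ⊥) (hy1 : y ≠ ⊤) (h : star x = star y) : x ≤ y := by
  have h1 : x ⊓ (star x)ᶜ ≤ y ⊔ star y := by
    rw [← hs.star_compl hx0 hx1]
    exact inf_eq_left.1 (hR.out.regular x y)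
  -- Apply `ᶜ` to `yᶜ ⊓ star yᶜ = ⊥`.
  have h2 : y ⊔ (star x)ᶜ = ⊤ := by
    rw [h, ← hs.star_compl hy0 hy1, ← bot_compl, ← inf_star yᶜ, inf_compl, compl_compl_eq]
  calc x = x ⊓ (y ⊔ (star x)ᶜ) := by rw [h2, inf_top]
    _ = (x ⊓ y) ⊔ (x ⊓ (star x)ᶜ) := inf_sup_left _ _ _
    _ ≤ y := ?_
  refine sup_le inf_le_right ?_
  calc x ⊓ (star x)ᶜ ≤ x ⊓ (y ⊔ star y) := le_inf inf_le_left h1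
    _ = (x ⊓ y) ⊔ (x ⊓ star x) := by rw [inf_sup_left, h]
    _ ≤ y := by rw [inf_star, sup_bot]; exact inf_le_right

theorem IsSimple.compl_eq_self (hs : IsSimple Q) {x : Q} (h0 : x ≠ ⊥) (h1 : x ≠ ⊤) :
    xᶜ = x :=
  le_antisymm
    (hs.le_of_star_eq (compl_ne_bot h1) (compl_ne_top h0) h0 h1 (hs.star_compl h0 h1))
    (hs.le_of_star_eq h0 h1 (compl_ne_bot h1) (compl_ne_top h0) (hs.star_compl h0 h1).symm)

/-- On the elements strictly between `⊥` and `⊤`, `ᶜ` is the identity and yet reverses order. -/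
theorem IsSimple.eq_of_le (hs : IsSimple Q) {x y : Q} (hx0 : x ≠ ⊥) (hy1 : y ≠ ⊤) (h : x ≤ y) :
    x = y := by
  have hy0 : y ≠ ⊥ := fun h' => hx0 (eq_bot_of_le (h' ▸ h))
  have hx1 : x ≠ ⊤ := fun h' => hy1 (eq_top_of_le (h' ▸ h))
  refine le_antisymm h ?_
  rw [← hs.compl_eq_self hx0 hx1, ← hs.compl_eq_self hy0 hy1]
  exact compl_le h

theorem IsSimple.inf_eq_bot (hs : IsSimple Q) {x y : Q} (hx1 : x ≠ ⊤) (hy1 : y ≠ ⊤)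
    (h : x ≠ y) : x ⊓ y = ⊥ := by
  by_contra h0
  exact h ((hs.eq_of_le h0 hx1 inf_le_left).symm.trans (hs.eq_of_le h0 hy1 inf_le_right))

theorem imp_compl : ((⊥ : Q) ⇨ ⊤)ᶜ = ⊥ ⇨ ⊤ := hR.out.unorthodox

theorem IsSimple.imp_ne_bot (hs : IsSimple Q) : (⊥ : Q) ⇨ ⊤ ≠ ⊥ := by
  intro h
  have := imp_compl (Q := Q)
  rw [h, bot_compl] at this
  exact hs.bot_ne_top this.symm

theorem IsSimple.imp_ne_top (hs : IsSimple Q) : (⊥ : Q) ⇨ ⊤ ≠ ⊤ := by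
  intro h
  have := imp_compl (Q := Q)
  rw [h, top_compl] at this
  exact hs.bot_ne_top this

theorem isHom_chainAlg {imp : Fin 3 → Fin 3 → Fin 3} {a : Q} (ha : aᶜ = a)
    (himp : ∀ x y, ![⊥, ⊤, a] (imp x y) = ![⊥, ⊤, a] x ⇨ ![⊥, ⊤, a] y) :
    IsHom (A := (chainAlg imp).carrier) (![⊥, ⊤, a] : Fin 3 → Q) where
  map_sup := by
    intro (x : Fin 3) (y : Fin 3)
    fin_cases x <;> fin_cases y <;>
      first
      | exact (bot_sup _).symm
      | exact (sup_bot _).symm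
      | exact (top_sup _).symm
      | exact (sup_top _).symm
      | exact (sup_idem _).symm
  map_inf := by
    intro (x : Fin 3) (y : Fin 3)
    fin_cases x <;> fin_cases y <;>
      first
      | exact (bot_inf _).symm
      | exact (inf_bot _).symm
      | exact (top_inf _).symm
      | exact (inf_top _).symm
      | exact (inf_idem _).symm
  map_imp := himp
  map_compl := by
    intro (x : Fin 3)
    fin_cases x
    · exact bot_compl.symm
    · exact top_compl.symm
    · exact ha.symm
  map_bot := rfl
  map_top := rfl

/-- The semi-Heyting laws fix every entry of the table except `⊥ ⇨ a` and `a ⇨ ⊤`, and each of these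
lies above `a`, so it is `a` or `⊤`. -/
theorem IsSimple.exists_of_chain (hs : IsSimple Q)
    (h : ∀ x : Q, x = ⊥ ∨ x = ⊤ ∨ x = ⊥ ⇨ ⊤) :
    ∃ (i : Label) (g : i.alg.carrier → Q), IsHom g ∧ Function.Bijective g := by
  have ha0 := hs.imp_ne_bot
  have ha1 := hs.imp_ne_top
  have hac := imp_compl (Q := Q)
  have h01 : (⊥ : Q) ⇨ ⊤ = ⊥ ⇨ ⊤ := rfl
  generalize ha : (⊥ : Q) ⇨ ⊤ = a at *
  have h20 : a ⇨ ⊥ = ⊥ := by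
    have := inf_imp a ⊥
    rw [inf_bot] at this
    rcases h (a ⇨ ⊥) with h' | h' | h'
    · exact h'
    · rw [h', inf_top] at this
      exact absurd this ha0
    · rw [h', inf_idem] at this
      exact absurd this ha0
  have hal : ∀ x, a ⊓ x = a → x = ⊤ ∨ x = a := by
    intro x hx
    rcases h x with rfl | rfl | rfl
    · rw [inf_bot] at hx
      exact absurd hx.symm ha0
    · exact Or.inl rfl
    · exact Or.inr rfl
  have h21 : a ⇨ ⊤ = ⊤ ∨ a ⇨ ⊤ = a := hal _ (by rw [inf_imp, inf_top])
  -- Localizing `⊥ ⇨ ⊤ = a` at `a` gives `a ≤ ⊥ ⇨ a`.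
  have h02 : ⊥ ⇨ a = ⊤ ∨ ⊥ ⇨ a = a := hal _ (by
    have := inf_imp_inf a ⊥ ⊤
    rw [ha, inf_idem, inf_top, inf_bot] at this
    rw [inf_imp_inf, inf_idem, inf_bot, ← this])
  have hbij : Function.Bijective (![⊥, ⊤, a] : Fin 3 → Q) := by
    constructor
    · intro x y hxy
      fin_cases x <;> fin_cases y <;> first | rfl | (exfalso; revert hxy)
      exacts [hs.bot_ne_top, ha0.symm, hs.bot_ne_top.symm, ha1.symm, ha0, ha1]
    · intro x
      rcases h x with rfl | rfl | rfl
      exacts [⟨0, rfl⟩, ⟨1, rfl⟩, ⟨2, rfl⟩]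
  have hb := imp_self (⊥ : Q)
  have ht := imp_self (⊤ : Q)
  have haa := imp_self a
  have ht0 := top_imp (⊥ : Q)
  have hta := top_imp a
  rcases h02 with h02 | h02 <;> rcases h21 with h21 | h21
  · refine ⟨.a1, _, isHom_chainAlg hac ?_, hbij⟩
    intro x y
    fin_cases x <;> fin_cases y <;> symm <;> assumption
  · refine ⟨.a2, _, isHom_chainAlg hac ?_, hbij⟩
    intro x y
    fin_cases x <;> fin_cases y <;> symm <;> assumption
  · refine ⟨.a3, _, isHom_chainAlg hac ?_, hbij⟩
    intro x y
    fin_cases x <;> fin_cases y <;> symm <;> assumption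
  · refine ⟨.a4, _, isHom_chainAlg hac ?_, hbij⟩
    intro x y
    fin_cases x <;> fin_cases y <;> symm <;> assumption

/-- Two distinct middle elements meet in `⊥`, so, being fixed by `ᶜ`, they join to `⊤`. A further
middle element would be disjoint from both and hence `⊥`. -/
theorem IsSimple.exists_of_square (hs : IsSimple Q) {b : Q} (hb0 : b ≠ ⊥) (hb1 : b ≠ ⊤)
    (hba : b ≠ ⊥ ⇨ ⊤) :
    ∃ (i : Label) (g : i.alg.carrier → Q), IsHom g ∧ Function.Bijective g := by
  have ha0 := hs.imp_ne_bot
  have ha1 := hs.imp_ne_top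
  have hac := imp_compl (Q := Q)
  have h01 : (⊥ : Q) ⇨ ⊤ = ⊥ ⇨ ⊤ := rfl
  generalize ha : (⊥ : Q) ⇨ ⊤ = a at *
  have hbc : bᶜ = b := hs.compl_eq_self hb0 hb1
  have hab : a ⊓ b = ⊥ := hs.inf_eq_bot ha1 hb1 hba.symm
  have hab' : b ⊓ a = ⊥ := by rw [inf_comm, hab]
  have hsup : a ⊔ b = ⊤ := by rw [← bot_compl, ← hab, inf_compl, hac, hbc]
  have hsup' : b ⊔ a = ⊤ := by rw [sup_comm, hsup]
  have hall : ∀ x : Q, x = ⊥ ∨ x = ⊤ ∨ x = a ∨ x = b := by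
    intro x
    by_cases h0 : x = ⊥
    · exact Or.inl h0
    by_cases h1 : x = ⊤
    · exact Or.inr (Or.inl h1)
    by_cases hxa : x = a
    · exact Or.inr (Or.inr (Or.inl hxa))
    refine Or.inr (Or.inr (Or.inr ?_))
    by_contra hxb
    apply h0
    rw [← inf_top x, ← hsup, inf_sup_left, hs.inf_eq_bot h1 ha1 hxa, hs.inf_eq_bot h1 hb1 hxb,
      sup_bot]
  have hbij : Function.Bijective (![⊥, ⊤, a, b] : Fin 4 → Q) := by
    constructor
    · intro x y hxy
      fin_cases x <;> fin_cases y <;> first | rfl | (exfalso; revert hxy)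
      exacts [hs.bot_ne_top, ha0.symm, hb0.symm, hs.bot_ne_top.symm, ha1.symm, hb1.symm, ha0, ha1,
        hba.symm, hb0, hb1, hba]
    · intro x
      rcases hall x with rfl | rfl | rfl | rfl
      exacts [⟨0, rfl⟩, ⟨1, rfl⟩, ⟨2, rfl⟩, ⟨3, rfl⟩]
  -- An element is determined by its parts below `a` and `b`. Below `a`, `⊥ ⇨ ⊤` is everything;
  -- below `b` it is `⊥`. This fixes every entry of the table.
  have split : ∀ x y : Q, a ⊓ x = a ⊓ y → b ⊓ x = b ⊓ y → x = y := by
    intro x y h1 h2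
    rw [← top_inf x, ← top_inf y, ← hsup, inf_sup_right, inf_sup_right, h1, h2]
  have a01 : a ⊓ (⊥ ⇨ ⊤) = a := by rw [ha, inf_idem]
  have b01 : b ⊓ (⊥ ⇨ ⊤) = ⊥ := by rw [ha, hab']
  have a02 : a ⊓ (⊥ ⇨ a) = a := by
    rw [inf_imp_inf, inf_bot, inf_idem]
    rwa [inf_imp_inf, inf_bot, inf_top] at a01
  have b03 : b ⊓ (⊥ ⇨ b) = ⊥ := by
    rw [inf_imp_inf, inf_bot, inf_idem]
    rwa [inf_imp_inf, inf_bot, inf_top] at b01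
  have tables : ⊥ ⇨ a = ⊤ ∧ ⊥ ⇨ b = a ∧ a ⇨ ⊥ = b ∧ a ⇨ ⊤ = a ∧ a ⇨ b = ⊥ ∧
      b ⇨ ⊥ = a ∧ b ⇨ ⊤ = ⊤ ∧ b ⇨ a = a := by
    refine ⟨split _ _ ?_ ?_, split _ _ ?_ ?_, split _ _ ?_ ?_, split _ _ ?_ ?_, split _ _ ?_ ?_,
      split _ _ ?_ ?_, split _ _ ?_ ?_, split _ _ ?_ ?_⟩
    · exact a02.trans (inf_top a).symm
    · rw [inf_imp_inf, inf_bot, hab', imp_self]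
    · rw [inf_imp_inf, hab, inf_bot, imp_self, inf_top, inf_idem]
    · rw [b03, hab']
    · rw [inf_imp, inf_bot, hab]
    · rw [inf_imp_inf, hab', inf_bot, imp_self, inf_top, inf_idem]
    · rw [inf_imp, inf_top, inf_idem]
    · rw [inf_imp_inf, hab', inf_top, b03]
    · rw [inf_imp, hab, inf_bot]
    · rw [inf_imp_inf, hab', inf_idem, b03, inf_bot]
    · rw [inf_imp_inf, hab, inf_bot, imp_self, inf_top, inf_idem]
    · rw [inf_imp, inf_bot, hab']
    · rw [inf_imp_inf, hab, inf_top, a02]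
    · rw [inf_imp, inf_top]
    · rw [inf_imp_inf, hab, inf_idem, a02]
    · rw [inf_imp]
  obtain ⟨h02, h03, h20, h21, h23, h30, h31, h32⟩ := tables
  have hbb := imp_self (⊥ : Q)
  have htt := imp_self (⊤ : Q)
  have haa := imp_self a
  have hb := imp_self b
  have ht0 := top_imp (⊥ : Q)
  have hta := top_imp a
  have htb := top_imp b
  refine ⟨.a5, (![⊥, ⊤, a, b] : Fin 4 → Q), ⟨?_, ?_, ?_, ?_, rfl, rfl⟩, hbij⟩
  · intro (x : Fin 4) (y : Fin 4)
    fin_cases x <;> fin_cases y <;>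
      first
      | exact (bot_sup _).symm
      | exact (sup_bot _).symm
      | exact (top_sup _).symm
      | exact (sup_top _).symm
      | exact (sup_idem _).symm
      | exact hsup.symm
      | exact hsup'.symm
  · intro (x : Fin 4) (y : Fin 4)
    fin_cases x <;> fin_cases y <;>
      first
      | exact (bot_inf _).symm
      | exact (inf_bot _).symm
      | exact (top_inf _).symm
      | exact (inf_top _).symm
      | exact (inf_idem _).symm
      | exact hab.symm
      | exact hab'.symm
  · intro (x : Fin 4) (y : Fin 4)
    fin_cases x <;> fin_cases y <;> symm <;> assumption
  · intro (x : Fin 4)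
    fin_cases x
    · exact bot_compl.symm
    · exact top_compl.symm
    · exact hac.symm
    · exact hbc.symm

theorem IsSimple.exists_label (hs : IsSimple Q) :
    ∃ (i : Label) (g : i.alg.carrier → Q), IsHom g ∧ Function.Bijective g := by
  by_cases h : ∃ b : Q, b ≠ ⊥ ∧ b ≠ ⊤ ∧ b ≠ ⊥ ⇨ ⊤
  · obtain ⟨b, h0, h1, h2⟩ := h
    exact hs.exists_of_square h0 h1 h2
  · refine hs.exists_of_chain fun x => ?_
    by_contra! hx
    exact h ⟨x, hx⟩

end Simple

/-- The members of `RUNO1` are subdirect products of the five algebras. -/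
theorem exists_separating_hom {A : Type u} [Ops A] (hA : IsRUNO1 A) {a b : A} (hab : a ≠ b) :
    ∃ (i : Label) (f : A → i.alg.carrier), IsHom f ∧ Function.Surjective f ∧ f a ≠ f b := by
  have := Fact.mk hA
  obtain ⟨Q, opsQ, f, hf, hfs, hne, hQ⟩ := exists_simple_quotient hab
  have hRQ : IsRUNO1 Q := hA.of_surjective hf hfs
  have := Fact.mk hRQ
  have hs : IsSimple Q := by
    -- If `⊥ = ⊤`, the quotient has one element and cannot separate `a` from `b`.
    refine ⟨fun h => hne ?_, hQ⟩
    have : ∀ x : Q, x = ⊥ := fun x => eq_bot_of_le (h ▸ le_top' x)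
    rw [this (f a), this (f b)]
  obtain ⟨i, g, hg, hgb⟩ := hs.exists_label
  obtain ⟨k, hk, hkb⟩ := hg.inverse hgb
  exact ⟨i, fun x => k (f x), hk.comp hf, hkb.surjective.comp hfs, fun h => hne (hkb.injective h)⟩

/-! ### Derivability as a preorder on formulas. -/

section Hilbert

variable {Ax Γ : Set Fm}

/-- The formula `a →_H b` is derivable. -/
def DerivLe (Ax Γ : Set Fm) (a b : Fm) : Prop := Deriv Ax Γ (impH a b)

namespace DerivLe

variable (H : axSH ⊆ Ax)
include H

theorem le_sup_left (a b : Fm) : DerivLe Ax Γ a (a ⊔ b) :=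
  Deriv.ax (assign a b a) (H (show impH p (p ⊔ q) ∈ axSH by simp [axSH]))

theorem le_sup_right (a b : Fm) : DerivLe Ax Γ b (a ⊔ b) :=
  Deriv.ax (assign a b a) (H (show impH q (p ⊔ q) ∈ axSH by simp [axSH]))

theorem sup_le {a b c : Fm} (h1 : DerivLe Ax Γ a c) (h2 : DerivLe Ax Γ b c) :
    DerivLe Ax Γ (a ⊔ b) c :=
  .smp h2 (.smp h1 (Deriv.ax (assign a b c)
    (H (show impH (impH p r) (impH (impH q r) (impH (p ⊔ q) r)) ∈ axSH by simp [axSH]))))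

theorem inf_le_left (a b : Fm) : DerivLe Ax Γ (a ⊓ b) a :=
  Deriv.ax (assign a b a) (H (show impH (p ⊓ q) p ∈ axSH by simp [axSH]))

theorem le_inf {a b c : Fm} (h1 : DerivLe Ax Γ c a) (h2 : DerivLe Ax Γ c b) :
    DerivLe Ax Γ c (a ⊓ b) :=
  .smp h2 (.smp h1 (Deriv.ax (assign a b c)
    (H (show impH (impH r p) (impH (impH r q) (impH r (p ⊓ q))) ∈ axSH by simp [axSH]))))

theorem top : Deriv Ax Γ ⊤ :=
  Deriv.ax (φ := (⊤ : Fm)) (assign ⊤ ⊤ ⊤) (H (show (⊤ : Fm) ∈ axSH by simp [axSH]))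

theorem bot_le (a : Fm) : DerivLe Ax Γ ⊥ a :=
  Deriv.ax (assign a a a) (H (show impH ⊥ p ∈ axSH by simp [axSH]))

theorem curry {a b c : Fm} (h : DerivLe Ax Γ (a ⊓ b) c) : DerivLe Ax Γ a (impH b c) :=
  .smp h (Deriv.ax (assign a b c)
    (H (show impH (impH (p ⊓ q) r) (impH p (impH q r)) ∈ axSH by simp [axSH])))

theorem uncurry {a b c : Fm} (h : DerivLe Ax Γ a (impH b c)) : DerivLe Ax Γ (a ⊓ b) c :=
  .smp h (Deriv.ax (assign a b c)
    (H (show impH (impH p (impH q r)) (impH (p ⊓ q) r) ∈ axSH by simp [axSH])))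

theorem himp_left (a b c : Fm) :
    DerivLe Ax Γ (impH a b) (impH (impH b a) (impH (a ⇨ c) (b ⇨ c))) :=
  Deriv.ax (assign a b c)
    (H (show impH (impH p q) (impH (impH q p) (impH (p ⇨ r) (q ⇨ r))) ∈ axSH by simp [axSH]))

theorem himp_right (a b c : Fm) :
    DerivLe Ax Γ (impH a b) (impH (impH b a) (impH (c ⇨ b) (c ⇨ a))) :=
  Deriv.ax (assign a b c)
    (H (show impH (impH p q) (impH (impH q p) (impH (r ⇨ q) (r ⇨ p))) ∈ axSH by simp [axSH]))

theorem le_impH_self (a b : Fm) : DerivLe Ax Γ a (impH b a) := curry H (inf_le_left H a b)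

theorem of_deriv {a : Fm} (b : Fm) (h : Deriv Ax Γ a) : DerivLe Ax Γ b a :=
  .smp h (le_impH_self H a b)

/-- Weakening and uncurrying do this without transitivity, which is not yet available. -/
theorem inf_le_of_right {a b c : Fm} (h : DerivLe Ax Γ b c) : DerivLe Ax Γ (a ⊓ b) c :=
  uncurry H (of_deriv H a h)

theorem himp_left_le {a b : Fm} (h1 : DerivLe Ax Γ a b) (h2 : DerivLe Ax Γ b a) (c : Fm) :
    DerivLe Ax Γ (a ⇨ c) (b ⇨ c) :=
  .smp h2 (.smp h1 (himp_left H a b c))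

theorem himp_right_le {a b : Fm} (h1 : DerivLe Ax Γ a b) (h2 : DerivLe Ax Γ b a) (c : Fm) :
    DerivLe Ax Γ (c ⇨ b) (c ⇨ a) :=
  .smp h2 (.smp h1 (himp_right H a b c))

/-- The hypothesis `h1` is `a ⇨ (a ⊓ b)`; congruence on the right replaces `a ⊓ b` by `a ⊓ a`. -/
theorem refl_of_equiv {a b : Fm} (h1 : DerivLe Ax Γ a b) (h2 : DerivLe Ax Γ b a) :
    DerivLe Ax Γ a a := by
  have k1 : DerivLe Ax Γ (a ⊓ a) (a ⊓ b) := le_inf H (inf_le_left H a a) (inf_le_of_right H h1)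
  have k2 : DerivLe Ax Γ (a ⊓ b) (a ⊓ a) := le_inf H (inf_le_left H a b) (inf_le_of_right H h2)
  exact Deriv.smp h1 (himp_right_le H k1 k2 a)

/-- Every formula `a` is equivalent to `(⊤ →_H a) ⊓ ⊤`, whose first factor is provably below
itself. -/
theorem refl (a : Fm) : DerivLe Ax Γ a a := by
  have ht : DerivLe Ax Γ ⊤ ⊤ := of_deriv H ⊤ (top H)
  -- Left congruence for the pair `⊤`, `⊤` makes every implication out of `⊤` reflexive.
  have hx : DerivLe Ax Γ (impH ⊤ a) (impH ⊤ a) := himp_left_le H ht ht _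
  exact refl_of_equiv H (b := impH ⊤ a ⊓ ⊤)
    (le_inf H (le_impH_self H a ⊤) (of_deriv H a (top H))) (uncurry H hx)

theorem inf_le_right (a b : Fm) : DerivLe Ax Γ (a ⊓ b) b := inf_le_of_right H (refl H b)

theorem inf_comm_le (a b : Fm) : DerivLe Ax Γ (a ⊓ b) (b ⊓ a) :=
  le_inf H (inf_le_right H a b) (inf_le_left H a b)

/-- Congruence rewrites `b ⇨ (b ⊓ c)` into `a ⇨ (a ⊓ c)`, first on the right, then on the left. -/
theorem trans_of_equiv {a b c : Fm} (h1 : DerivLe Ax Γ a b) (h2 : DerivLe Ax Γ b a)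
    (h3 : DerivLe Ax Γ b c) : DerivLe Ax Γ a c := by
  have k1 : DerivLe Ax Γ (c ⊓ b) (c ⊓ a) := le_inf H (inf_le_left H c b) (inf_le_of_right H h2)
  have k2 : DerivLe Ax Γ (c ⊓ a) (c ⊓ b) := le_inf H (inf_le_left H c a) (inf_le_of_right H h1)
  have j1 : Deriv Ax Γ (b ⇨ (c ⊓ b)) :=
    .smp h3 (himp_right_le H (inf_comm_le H c b) (inf_comm_le H b c) b)
  have j2 : Deriv Ax Γ (b ⇨ (c ⊓ a)) := .smp j1 (himp_right_le H k2 k1 b)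
  have j3 : Deriv Ax Γ (b ⇨ (a ⊓ c)) :=
    .smp j2 (himp_right_le H (inf_comm_le H a c) (inf_comm_le H c a) b)
  exact Deriv.smp j3 (himp_left_le H h2 h1 _)

/-- If `a` is below `b`, it is equivalent to `a ⊓ b`, which is below `c` by `inf_le_of_right`. -/
theorem trans {a b c : Fm} (h1 : DerivLe Ax Γ a b) (h2 : DerivLe Ax Γ b c) : DerivLe Ax Γ a c :=
  trans_of_equiv H (b := a ⊓ b) (le_inf H (refl H a) h1) (inf_le_left H a b)
    (inf_le_of_right H h2)

theorem le_mp {x a b : Fm} (h1 : DerivLe Ax Γ x (impH a b)) (h2 : DerivLe Ax Γ x a) :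
    DerivLe Ax Γ x b :=
  trans H (le_inf H (refl H x) h2) (uncurry H h1)

/-- Congruence relative to a context `x`: the equivalence of `a` and `b` need only hold below `x`.
-/
theorem inf_himp_left {x a b : Fm} (c : Fm) (h1 : DerivLe Ax Γ x (impH a b))
    (h2 : DerivLe Ax Γ x (impH b a)) : DerivLe Ax Γ (x ⊓ (a ⇨ c)) (b ⇨ c) :=
  uncurry H (le_mp H (trans H h1 (himp_left H a b c)) h2)

theorem inf_himp_right {x a b : Fm} (c : Fm) (h1 : DerivLe Ax Γ x (impH a b))
    (h2 : DerivLe Ax Γ x (impH b a)) : DerivLe Ax Γ (x ⊓ (c ⇨ b)) (c ⇨ a) :=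
  uncurry H (le_mp H (trans H h1 (himp_right H a b c)) h2)

theorem le_impH_inf (x y : Fm) : DerivLe Ax Γ x (impH y (x ⊓ y)) := curry H (refl H _)

theorem le_inf_impH (x y : Fm) : DerivLe Ax Γ x (impH (x ⊓ y) y) :=
  of_deriv H x (inf_le_right H x y)

/-- In the context `x`, each of `y` and `z` is equivalent to its meet with `x`. -/
theorem inf_himp_inf_le (x y z : Fm) :
    DerivLe Ax Γ (x ⊓ (y ⇨ z)) (x ⊓ ((x ⊓ y) ⇨ (x ⊓ z))) := by
  have h1 := inf_himp_left H z (le_impH_inf (Γ := Γ) H x y) (le_inf_impH H x y)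
  have h2 := inf_himp_right H (x ⊓ y) (le_inf_impH (Γ := Γ) H x z) (le_impH_inf H x z)
  exact le_inf H (inf_le_left H _ _) (trans H (le_inf H (inf_le_left H _ _) h1) h2)

theorem inf_himp_inf_ge (x y z : Fm) :
    DerivLe Ax Γ (x ⊓ ((x ⊓ y) ⇨ (x ⊓ z))) (x ⊓ (y ⇨ z)) := by
  have h1 := inf_himp_left H (x ⊓ z) (le_inf_impH (Γ := Γ) H x y) (le_impH_inf H x y)
  have h2 := inf_himp_right H y (le_impH_inf (Γ := Γ) H x z) (le_inf_impH H x z)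
  exact le_inf H (inf_le_left H _ _) (trans H (le_inf H (inf_le_left H _ _) h1) h2)

theorem inf_himp_le (x y : Fm) : DerivLe Ax Γ (x ⊓ (x ⇨ y)) (x ⊓ y) := by
  have h := inf_himp_right H x (le_inf_impH (Γ := Γ) H x y) (le_impH_inf H x y)
  exact le_inf H (inf_le_left H _ _) (le_mp H h (inf_le_left H _ _))

theorem inf_le_himp (x y : Fm) : DerivLe Ax Γ (x ⊓ y) (x ⊓ (x ⇨ y)) := by
  have h := inf_himp_right H x (le_impH_inf (Γ := Γ) H x y) (le_inf_impH H x y)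
  refine le_inf H (inf_le_left H _ _) (trans H (le_inf H (inf_le_left H _ _) ?_) h)
  exact trans H (inf_le_right H x y) (le_impH_self H y x)

theorem himp_self (x : Fm) : Deriv Ax Γ (x ⇨ x) :=
  .smp (refl H x) (himp_right_le H (le_inf H (refl H x) (refl H x)) (inf_le_left H x x) x)

theorem of_iffH {a b : Fm} (h : Deriv Ax Γ (iffH a b)) : DerivLe Ax Γ a b ∧ DerivLe Ax Γ b a :=
  ⟨.smp h (inf_le_left H _ _), .smp h (inf_le_right H _ _)⟩

end DerivLe

end Hilbert

/-! ### The Lindenbaum–Tarski algebra. -/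

open DerivLe

theorem Fm.eval_var (φ : Fm) : φ.eval Fm.var = φ := by
  induction φ with
  | bot => rfl
  | top => rfl
  | var n => rfl
  | neg φ ih => exact congrArg Fm.neg ih
  | or φ ψ ih1 ih2 => exact congrArg₂ Fm.or ih1 ih2
  | and φ ψ ih1 ih2 => exact congrArg₂ Fm.and ih1 ih2
  | imp φ ψ ih1 ih2 => exact congrArg₂ Fm.imp ih1 ih2

/-- The Lindenbaum–Tarski algebra of a theory. -/
theorem exists_lindenbaum {Ax : Set Fm} (Γ : Set Fm) (hAx : axRUNO1 ⊆ Ax) :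
    ∃ (A : Type) (_ : Ops A) (h : ℕ → A), IsRUNO1 A ∧ (∀ φ ∈ Ax, Valid A φ) ∧
      ∀ φ : Fm, φ.eval h = ⊤ ↔ Deriv Ax Γ φ := by
  have H : axSH ⊆ Ax := fun φ hφ => hAx (Or.inl (Or.inl hφ))
  have axm : ∀ {φ ψ : Fm} (σ : ℕ → Fm), iffH φ ψ ∈ axRUNO1 →
      DerivLe Ax Γ (φ.eval σ) (ψ.eval σ) ∧ DerivLe Ax Γ (ψ.eval σ) (φ.eval σ) :=
    fun σ h => of_iffH H (Deriv.ax σ (hAx h))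
  let s : Setoid Fm :=
    { r := fun a b => DerivLe Ax Γ a b ∧ DerivLe Ax Γ b a
      iseqv :=
        { refl := fun a => ⟨refl H a, refl H a⟩
          symm := fun h => h.symm
          trans := fun h k => ⟨trans H h.1 k.1, trans H k.2 h.2⟩ } }
  have sup_mono : ∀ {a b c d : Fm}, DerivLe Ax Γ a b → DerivLe Ax Γ c d →
      DerivLe Ax Γ (a ⊔ c) (b ⊔ d) := fun h k =>
    sup_le H (trans H h (le_sup_left H _ _)) (trans H k (le_sup_right H _ _))
  have inf_mono : ∀ {a b c d : Fm}, DerivLe Ax Γ a b → DerivLe Ax Γ c d →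
      DerivLe Ax Γ (a ⊓ c) (b ⊓ d) := fun h k =>
    le_inf H (trans H (inf_le_left H _ _) h) (trans H (inf_le_right H _ _) k)
  have himp_mono : ∀ {a b c d : Fm}, a ≈ b → c ≈ d → DerivLe Ax Γ (a ⇨ c) (b ⇨ d) :=
    fun h k => trans H (himp_left_le H h.1 h.2 _) (himp_right_le H k.2 k.1 _)
  let ops : Ops (Quotient s) :=
    { max := Quotient.map₂ (· ⊔ ·) fun _ _ h _ _ k => ⟨sup_mono h.1 k.1, sup_mono h.2 k.2⟩
      min := Quotient.map₂ (· ⊓ ·) fun _ _ h _ _ k => ⟨inf_mono h.1 k.1, inf_mono h.2 k.2⟩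
      himp := Quotient.map₂ (· ⇨ ·) fun _ _ h _ _ k =>
        ⟨himp_mono h k, himp_mono (Setoid.symm h) (Setoid.symm k)⟩
      compl := Quotient.map (·ᶜ) fun _ _ h => ⟨.scp h.2, .scp h.1⟩
      bot := ⟦⊥⟧
      top := ⟦⊤⟧ }
  let π : Fm → Quotient s := fun φ => ⟦φ⟧
  have hπ : IsHom π := ⟨fun _ _ => rfl, fun _ _ => rfl, fun _ _ => rfl, fun _ => rfl, rfl, rfl⟩
  have eq_top : ∀ φ : Fm, π φ = ⊤ ↔ Deriv Ax Γ φ := fun φ =>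
    ⟨fun h => .smp (top H) (Quotient.exact h).2,
      fun h => Quotient.sound ⟨of_deriv H φ (top H), of_deriv H ⊤ h⟩⟩
  have hcc : ∀ x : Quotient s, xᶜᶜ = x := by
    rintro ⟨a⟩
    exact Quotient.sound (axm (φ := pᶜᶜ) (ψ := p) (assign a a a) (by simp [axRUNO1, axDM]))
  have hidem : ∀ x : Quotient s, x ⊓ x = x := by
    rintro ⟨a⟩
    exact Quotient.sound ⟨inf_le_left H _ _, le_inf H (refl H _) (refl H _)⟩
  have htop : ((⊥ : Quotient s))ᶜ = ⊤ :=
    (Quotient.sound (axm (φ := ⊤) (ψ := (⊥ : Fm)ᶜ) (assign ⊥ ⊥ ⊥)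
      (by simp [axRUNO1, axDM])) : (⟦⊤⟧ : Quotient s) = ⟦(⊥ : Fm)ᶜ⟧).symm
  refine ⟨Quotient s, ops, fun n => ⟦.var n⟧, ?_, ?_, ?_⟩
  · exact
      { sup_comm := by
          rintro ⟨a⟩ ⟨b⟩
          exact Quotient.sound ⟨sup_le H (le_sup_right H _ _) (le_sup_left H _ _),
            sup_le H (le_sup_right H _ _) (le_sup_left H _ _)⟩
        inf_comm := by
          rintro ⟨a⟩ ⟨b⟩
          exact Quotient.sound ⟨inf_comm_le H _ _, inf_comm_le H _ _⟩
        sup_assoc := by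
          rintro ⟨a⟩ ⟨b⟩ ⟨c⟩
          exact Quotient.sound
            ⟨sup_le H (sup_mono (refl H _) (le_sup_left H _ _))
              (trans H (le_sup_right H _ _) (le_sup_right H _ _)),
            sup_le H (trans H (le_sup_left H _ _) (le_sup_left H _ _))
              (sup_mono (le_sup_right H _ _) (refl H _))⟩
        inf_assoc := by
          rintro ⟨a⟩ ⟨b⟩ ⟨c⟩
          exact Quotient.sound
            ⟨le_inf H (trans H (inf_le_left H _ _) (inf_le_left H _ _))
              (inf_mono (inf_le_right H _ _) (refl H _)),
            le_inf H (inf_mono (refl H _) (inf_le_left H _ _))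
              (trans H (inf_le_right H _ _) (inf_le_right H _ _))⟩
        sup_inf_self := by
          rintro ⟨a⟩ ⟨b⟩
          exact Quotient.sound ⟨sup_le H (refl H _) (inf_le_left H _ _), le_sup_left H _ _⟩
        inf_sup_self := by
          rintro ⟨a⟩ ⟨b⟩
          exact Quotient.sound ⟨inf_le_left H _ _, le_inf H (refl H _) (le_sup_left H _ _)⟩
        sup_bot := by
          rintro ⟨a⟩
          exact Quotient.sound ⟨sup_le H (refl H _) (bot_le H _), le_sup_left H _ _⟩
        inf_top := by
          rintro ⟨a⟩
          exact Quotient.sound ⟨inf_le_left H _ _, le_inf H (refl H _) (of_deriv H _ (top H))⟩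
        inf_imp := by
          rintro ⟨a⟩ ⟨b⟩
          exact Quotient.sound ⟨inf_himp_le H _ _, inf_le_himp H _ _⟩
        inf_imp_inf := by
          rintro ⟨a⟩ ⟨b⟩ ⟨c⟩
          exact Quotient.sound ⟨inf_himp_inf_le H _ _ _, inf_himp_inf_ge H _ _ _⟩
        imp_self := by
          rintro ⟨a⟩
          exact (eq_top _).2 (himp_self H a)
        bot_compl := htop
        top_compl := by rw [← htop, hcc]
        inf_compl := by
          rintro ⟨a⟩ ⟨b⟩
          exact Quotient.sound (axm (φ := (p ⊓ q)ᶜ) (ψ := pᶜ ⊔ qᶜ) (assign a b a)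
            (by simp [axRUNO1, axDM]))
        sup_compl_compl := fun x y => by rw [hcc, hcc, hcc]
        compl_compl_le := fun x => by rw [hcc, hidem]
        compl_compl := hcc
        unorthodox := Quotient.sound (axm (φ := ((⊥ : Fm) ⇨ ⊤)ᶜ) (ψ := ⊥ ⇨ ⊤) (assign ⊥ ⊥ ⊥)
          (by simp [axRUNO1]))
        regular := by
          rintro ⟨a⟩ ⟨b⟩
          have h := axm (φ := (p ⊓ (star pᶜ)ᶜ) ⊔ (q ⊔ star q)) (ψ := q ⊔ star q) (assign a b a)
            (by simp [axRUNO1])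
          exact Quotient.sound ⟨inf_le_left H _ _,
            le_inf H (refl H _) (trans H (le_sup_left H _ _) h.1)⟩
        level_one := by
          rintro ⟨a⟩
          exact Quotient.sound (Setoid.symm
            (axm (φ := star (p ⊓ star pᶜ)ᶜ) (ψ := p ⊓ star pᶜ) (assign a a a)
              (by simp [axRUNO1]))) }
  · intro φ hφ h
    -- Representatives turn an interpretation in the quotient into a substitution, and axioms are
    -- closed under substitution.
    choose σ hσ using fun n => Quotient.exists_rep (h n)
    rw [← funext hσ, ← hπ.map_eval σ φ, eq_top]
    exact Deriv.ax σ hφ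
  · intro φ
    rw [← hπ.map_eval Fm.var φ, φ.eval_var, eq_top]

/-! ### Subvarieties -/

/-- A copy of the algebra with label `i` in an arbitrary universe. -/
def Label.up (i : Label) : Alg.{u} where
  carrier := ULift i.alg.carrier
  ops :=
    { max := fun x y => ⟨x.down ⊔ y.down⟩
      min := fun x y => ⟨x.down ⊓ y.down⟩
      himp := fun x y => ⟨x.down ⇨ y.down⟩
      compl := fun x => ⟨x.downᶜ⟩
      bot := ⟨⊥⟩
      top := ⟨⊤⟩ }

def Label.toUp (i : Label) (x : i.alg.carrier) : i.up.{u}.carrier := ULift.up x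

theorem Label.isHom_toUp (i : Label) : IsHom i.toUp.{u} :=
  ⟨fun _ _ => rfl, fun _ _ => rfl, fun _ _ => rfl, fun _ => rfl, rfl, rfl⟩

theorem Label.toUp_bijective (i : Label) : Function.Bijective i.toUp.{u} :=
  Equiv.ulift.symm.bijective

theorem Label.bot_ne_top (i : Label) : (⊥ : i.alg.carrier) ≠ ⊤ := by
  cases i <;> decide +kernel

theorem isVariety_varietyGen (K : Set Alg.{u}) : IsVariety (varietyGen K) where
  closed_image A hA B f hf hs W hW hK := hW.closed_image A (hA W hW hK) B f hf hs
  closed_sub B hB A f hf hi W hW hK := hW.closed_sub B (hB W hW hK) A f hf hi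
  closed_pi ι F hF W hW hK := hW.closed_pi ι F fun i => hF i W hW hK

theorem isVariety_V (S : Set Label) : IsVariety (V.{u} S) := isVariety_varietyGen _

theorem up_mem_V {S : Set Label} {i : Label} (hi : i ∈ S) : i.up ∈ V.{u} S :=
  fun _ _ hK => hK ⟨i, hi, i.toUp, i.isHom_toUp, i.toUp_bijective⟩

theorem V_subset {S : Set Label} {W : Set Alg.{u}} (hW : IsVariety W)
    (h : ∀ i ∈ S, i.up ∈ W) : V S ⊆ W := by
  refine fun A hA => hA W hW ?_
  rintro B ⟨i, hi, f, hf, hb⟩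
  obtain ⟨g, hg, hgb⟩ := i.isHom_toUp.inverse i.toUp_bijective
  exact hW.closed_image i.up (h i hi) B _ (hf.comp hg) (hb.surjective.comp hgb.surjective)

theorem isRUNO1_up (i : Label) : IsRUNO1 i.up.{u}.carrier :=
  (isRUNO1_label i).of_surjective i.isHom_toUp i.toUp_bijective.surjective

theorem isVariety_RUNO1 : IsVariety RUNO1.{u} := by
  have h := isVariety_modelClass.{u} []
  simp only [modelClass, List.not_mem_nil, false_imp_iff, implies_true, and_true] at h
  exact h

theorem V_subset_RUNO1 (S : Set Label) : V.{u} S ⊆ RUNO1 :=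
  V_subset isVariety_RUNO1 fun i _ => isRUNO1_up i

/-- The labels of the algebras, up to isomorphism, in `W`. -/
def labels (W : Set Alg.{u}) : Set Label := {i | i.up ∈ W}

theorem IsVariety.mem_labels {W : Set Alg.{u}} (hW : IsVariety W) {A : Alg.{u}} (hA : A ∈ W)
    {i : Label} {f : A.carrier → i.alg.carrier} (hf : IsHom f) (hs : Function.Surjective f) :
    i ∈ labels W :=
  hW.closed_image A hA i.up _ (i.isHom_toUp.comp hf) (i.toUp_bijective.surjective.comp hs)

/-- Each `A` in `W` embeds in a product indexed by its pairs of distinct elements. The factors are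
homomorphic images of `A`, so their labels belong to `W`. -/
theorem IsVariety.eq_V_labels {W : Set Alg.{u}} (hW : IsVariety W) (hR : W ⊆ RUNO1) :
    V (labels W) = W := by
  refine Set.Subset.antisymm (V_subset hW fun i hi => hi) fun A hA => ?_
  choose i f hf hs hne using
    fun x : {x : A.carrier × A.carrier // x.1 ≠ x.2} => exists_separating_hom (hR hA) x.2
  let F : {x : A.carrier × A.carrier // x.1 ≠ x.2} → Alg.{u} := fun x => (i x).up
  refine (isVariety_V _).closed_sub (Alg.pi F)
    ((isVariety_V _).closed_pi _ F fun x => up_mem_V (hW.mem_labels hA (hf x) (hs x)))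
    A (fun a x => (i x).toUp (f x a)) ?_ ?_
  · have hc := fun x => (i x).isHom_toUp.comp (hf x)
    exact ⟨fun a b => funext fun x => (hc x).map_sup a b,
      fun a b => funext fun x => (hc x).map_inf a b,
      fun a b => funext fun x => (hc x).map_imp a b,
      fun a => funext fun x => (hc x).map_compl a,
      funext fun x => (hc x).map_bot, funext fun x => (hc x).map_top⟩
  · intro a b hab
    by_contra h
    have := congrFun hab ⟨(a, b), h⟩
    exact hne ⟨(a, b), h⟩ ((i _).toUp_bijective.injective this)

/-- The relation `{ψ ≈ 1 : ψ ∈ Γ} ⊨ φ ≈ 1` over a single algebra. -/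
def Entails (A : Type u) [Ops A] (Γ : Set Fm) (φ : Fm) : Prop :=
  ∀ h : ℕ → A, (∀ ψ ∈ Γ, ψ.eval h = ⊤) → φ.eval h = ⊤

/-- A counterexample in a member of `W` survives under a homomorphism that separates the value of
`φ` from `⊤`; the premises stay at `⊤`. -/
theorem IsVariety.conseq_iff {W : Set Alg.{u}} (hW : IsVariety W) (hR : W ⊆ RUNO1)
    (Γ : Set Fm) (φ : Fm) :
    conseq W Γ φ ↔ ∀ i ∈ labels W, Entails i.alg.carrier Γ φ := by
  constructor
  · intro H i hi h hΓ
    apply i.toUp_bijective.injective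
    rw [i.isHom_toUp.map_eval, i.isHom_toUp.map_top]
    refine H i.up hi _ fun ψ hψ => ?_
    rw [← i.isHom_toUp.map_eval, hΓ ψ hψ, i.isHom_toUp.map_top]
  · intro H A hA h hΓ
    by_contra hne
    obtain ⟨i, f, hf, hs, hf'⟩ := exists_separating_hom (hR hA) hne
    apply hf'
    rw [hf.map_eval, hf.map_top]
    refine H i (hW.mem_labels hA hf hs) _ fun ψ hψ => ?_
    rw [← hf.map_eval, hΓ ψ hψ, hf.map_top]

theorem Valid.of_surjective {A : Type u} {B : Type v} [Ops A] [Ops B] {φ : Fm} (H : Valid A φ)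
    {f : A → B} (hf : IsHom f) (hs : Function.Surjective f) : Valid B φ := by
  intro h
  choose k hk using fun n => hs (h n)
  rw [← funext hk, ← hf.map_eval, H, hf.map_top]

theorem Valid.of_injective {A : Type u} {B : Type v} [Ops A] [Ops B] {φ : Fm} (H : Valid B φ)
    {f : A → B} (hf : IsHom f) (hi : Function.Injective f) : Valid A φ := by
  intro h
  apply hi
  rw [hf.map_eval, H, hf.map_top]

/-- Each listed base is valid in exactly those of the five algebras that its set names. -/
theorem bases_valid_iff {b : Set Label × List Fm} (hb : b ∈ bases) (i : Label) :
    (∀ φ ∈ b.2, Valid i.alg.carrier φ) ↔ i ∈ b.1 := by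
  rw [bases_eq_map, List.mem_map] at hb
  obtain ⟨c, hc, rfl⟩ := hb
  rw [Finset.mem_coe, ← finBases_table c hc i]
  exact forall₂_congr fun φ hφ => valid_iff_assign (finBases_bound c hc φ hφ)

/-- The models of the base form a variety containing the generators, hence all of `V b.1`; the base
fails in every algebra not named. -/
theorem labels_V {b : Set Label × List Fm} (hb : b ∈ bases) : labels (V.{u} b.1) = b.1 := by
  refine Set.Subset.antisymm (fun i hi => ?_) fun i hi => up_mem_V hi
  have hsub : V.{u} b.1 ⊆ modelClass b.2 := V_subset (isVariety_modelClass _) fun j hj =>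
    ⟨isRUNO1_up j, fun φ hφ => ((bases_valid_iff hb j).2 hj φ hφ).of_surjective j.isHom_toUp
      j.toUp_bijective.surjective⟩
  exact (bases_valid_iff hb i).1 fun φ hφ =>
    ((hsub hi).2 φ hφ).of_injective i.isHom_toUp i.toUp_bijective.injective

theorem bases_nodup : (bases.map Prod.fst).Nodup := by
  have : bases.map Prod.fst = (finBases.map Prod.fst).map fun S : Finset Label => (S : Set Label) := by
    rw [bases_eq_map, List.map_map, List.map_map]
    rfl
  rw [this]
  exact finBases_nodup.map Finset.coe_injective

theorem exists_mem_bases {S : Set Label} (hS : S.Nonempty) : ∃ b ∈ bases, b.1 = S := by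
  classical
  have hS' : S.toFinset.Nonempty := by simpa using hS
  obtain ⟨c, hc, hcS⟩ := List.mem_map.1 (finBases_complete _ hS')
  refine ⟨((c.1 : Set Label), c.2), ?_, by simp [hcS]⟩
  rw [bases_eq_map]
  exact List.mem_map_of_mem hc

theorem nonempty_of_mem_bases {b : Set Label × List Fm} (hb : b ∈ bases) : b.1.Nonempty := by
  have H : ∀ c ∈ finBases, c.1.Nonempty := by decide +kernel
  rw [bases_eq_map, List.mem_map] at hb
  obtain ⟨c, hc, rfl⟩ := hb
  exact H c hc

theorem bijOn_bases :
    Set.BijOn (fun b => V.{u} b.1) {b | b ∈ bases} nontrivialSubvarieties.{u} := by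
  refine ⟨fun b hb => ⟨isVariety_V _, V_subset_RUNO1 _, ?_⟩, fun b hb c hc h => ?_, ?_⟩
  · obtain ⟨i, hi⟩ := nonempty_of_mem_bases hb
    exact ⟨i.up, up_mem_V hi, ⟨i.toUp ⊥, i.toUp ⊤,
      fun h => i.bot_ne_top (i.toUp_bijective.injective h)⟩⟩
  · have h' : b.1 = c.1 := by
      rw [← labels_V.{u} hb, ← labels_V.{u} hc]
      exact congrArg labels h
    exact List.inj_on_of_nodup_map bases_nodup hb hc h'
  · rintro W ⟨hW, hR, A, hA, a, a', hne⟩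
    obtain ⟨i, f, hf, hs, -⟩ := exists_separating_hom (hR hA) hne
    obtain ⟨b, hb, hbS⟩ := exists_mem_bases ⟨i, hW.mem_labels hA hf hs⟩
    exact ⟨b, hb, by simp only [hbS, hW.eq_V_labels hR]⟩

theorem ncard_nontrivialSubvarieties : nontrivialSubvarieties.{u}.ncard = 31 := by
  classical
  rw [← bijOn_bases.image_eq, bijOn_bases.injOn.ncard_image]
  have : {b | b ∈ bases} = (bases.toFinset : Set (Set Label × List Fm)) := by
    ext b
    simp
  rw [this, Set.ncard_coe_finset, List.toFinset_card_of_nodup (bases_nodup.of_map _)]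
  rfl

/-! ### Completeness -/

def axiomList : List Fm :=
  [ impH p (p ⊔ q),
    impH q (p ⊔ q),
    impH (impH p r) (impH (impH q r) (impH (p ⊔ q) r)),
    impH (p ⊓ q) p,
    impH (impH r p) (impH (impH r q) (impH r (p ⊓ q))),
    ⊤,
    impH ⊥ p,
    impH (impH (p ⊓ q) r) (impH p (impH q r)),
    impH (impH p (impH q r)) (impH (p ⊓ q) r),
    impH (impH p q) (impH (impH q p) (impH (p ⇨ r) (q ⇨ r))),
    impH (impH p q) (impH (impH q p) (impH (r ⇨ q) (r ⇨ p))),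
    iffH ⊤ (⊥ : Fm)ᶜ,
    iffH (p ⊓ q)ᶜ (pᶜ ⊔ qᶜ),
    iffH (p ⊔ q)ᶜ (pᶜ ⊓ qᶜ),
    iffH pᶜᶜ p,
    iffH ((⊥ : Fm) ⇨ ⊤)ᶜ (⊥ ⇨ ⊤),
    iffH ((p ⊓ (star pᶜ)ᶜ) ⊔ (q ⊔ star q)) (q ⊔ star q),
    iffH (star (p ⊓ star pᶜ)ᶜ) (p ⊓ star pᶜ) ]

theorem mem_axiomList {φ : Fm} (h : φ ∈ axRUNO1) : φ ∈ axiomList := by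
  simp only [axRUNO1, axSH, axDM, Set.mem_union, Set.mem_insert_iff, Set.mem_singleton_iff] at h
  simp only [axiomList, List.mem_cons]
  tauto

theorem valid_axRUNO1 {φ : Fm} (h : φ ∈ axRUNO1) (i : Label) : Valid i.alg.carrier φ := by
  have hb : ∀ φ ∈ axiomList, φ.bound ≤ 3 := by decide +kernel
  have hv : ∀ φ ∈ axiomList, ∀ (i : Label) (x y z : i.alg.carrier),
      φ.eval (assign x y z) = ⊤ := by decide +kernel
  have hφ := mem_axiomList h
  exact (valid_iff_assign (hb φ hφ)).2 (hv φ hφ i)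

theorem Deriv.sound {A : Type u} [Ops A] (hA : IsRUNO1 A) {Ax Γ : Set Fm}
    (hAx : ∀ φ ∈ Ax, Valid A φ) {φ : Fm} (H : Deriv Ax Γ φ) : Entails A Γ φ := by
  have := Fact.mk hA
  intro h hΓ
  have hom : IsHom (Fm.eval h) :=
    ⟨fun _ _ => rfl, fun _ _ => rfl, fun _ _ => rfl, fun _ => rfl, rfl, rfl⟩
  have eval_impH : ∀ φ ψ : Fm, (impH φ ψ).eval h = impH (φ.eval h) (ψ.eval h) :=
    fun _ _ => rfl
  induction H with
  | hyp hφ => exact hΓ _ hφ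
  | ax σ hφ => rw [hom.map_eval]; exact hAx _ hφ _
  | smp _ _ ih1 ih2 =>
    rw [eval_impH, impH_eq_top, ih1] at ih2
    exact eq_top_of_le ih2
  | scp _ ih =>
    rw [eval_impH, impH_eq_top] at ih ⊢
    exact compl_le ih

/-- For completeness, a formula not derivable from `Γ` differs from `⊤` in the Lindenbaum–Tarski
algebra of `Γ`. A separating homomorphism maps onto some `i.alg`; being onto, it carries the base
along, so `i ∈ b.1`. No finiteness of `Γ` is needed. -/
theorem isLogicOf_bases {b : Set Label × List Fm} (hb : b ∈ bases) :
    IsLogicOf (ext b.2) (V.{u} b.1) where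
  complete Γ φ := by
    rw [(isVariety_V.{u} b.1).conseq_iff (V_subset_RUNO1 _), labels_V hb]
    constructor
    · intro H i hi
      refine H.sound (isRUNO1_label i) ?_
      rintro ψ (hψ | hψ)
      · exact valid_axRUNO1 hψ i
      · exact (bases_valid_iff hb i).2 hi ψ hψ
    · intro H
      by_contra hφ
      obtain ⟨A, opsA, h, hA, hAx, hder⟩ :=
        exists_lindenbaum (Ax := axRUNO1 ∪ {φ | φ ∈ b.2}) Γ Set.subset_union_left
      obtain ⟨i, f, hf, hs, hne⟩ := exists_separating_hom hA (mt (hder φ).1 hφ)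
      apply hne
      rw [hf.map_eval, hf.map_top]
      refine H i ((bases_valid_iff hb i).1 fun ψ hψ => ?_) _ fun ψ hψ => ?_
      · exact (hAx ψ (Or.inr hψ)).of_surjective hf hs
      · rw [← hf.map_eval, (hder ψ).2 (.hyp hψ), hf.map_top]
  equivalence φ ψ A hA h := by
    have : Fact (IsRUNO1 A.carrier) := ⟨V_subset_RUNO1 _ hA⟩
    exact eq_iff_impH

/-! ### Decidability -/

theorem Fm.bound_le_enc (φ : Fm) : φ.bound ≤ φ.enc := by
  induction φ with
  | bot => exact le_rfl
  | top => exact Nat.zero_le _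
  | var n => simp only [Fm.bound, Fm.enc]; omega
  | neg φ ih => simp only [Fm.bound, Fm.enc]; omega
  | or φ ψ ih1 ih2 | and φ ψ ih1 ih2 | imp φ ψ ih1 ih2 =>
    have h1 := Nat.left_le_pair φ.enc ψ.enc
    have h2 := Nat.right_le_pair φ.enc ψ.enc
    simp only [Fm.bound, Fm.enc]
    omega

theorem encode_fm (φ : Fm) : Encodable.encode φ = φ.enc := rfl

theorem encode_le_of_mem_list {α : Type*} [Encodable α] {a : α} {l : List α} (h : a ∈ l) :
    Encodable.encode a ≤ Encodable.encode l := by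
  induction l with
  | nil => simp at h
  | cons b l ih =>
    rw [Encodable.encode_list_cons]
    rcases List.mem_cons.1 h with rfl | h
    · exact (Nat.left_le_pair _ _).trans (Nat.le_succ _)
    · exact (ih h).trans ((Nat.right_le_pair _ _).trans (Nat.le_succ _))

/-- All lists of length `N` over the list `l`. -/
def words {A : Type u} (l : List A) (N : ℕ) : List (List A) :=
  N.rec [[]] fun _ L => L.flatMap fun v => l.map fun a => a :: v

theorem primrec_words {A : Type u} [Primcodable A] (l : List A) : Primrec (words l) := by
  refine Primrec.nat_rec₁ [[]] ?_
  refine Primrec.list_flatMap Primrec.snd ?_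
  refine Primrec.list_map (Primrec.const l) ?_
  exact Primrec.list_cons.comp Primrec.snd (Primrec.snd.comp Primrec.fst)

section Evaluation

variable {A : Type u} [Ops A]

/-- The interpretation that sends the `n`-th variable to the `n`-th entry of `v`. -/
def valuation (v : List A) (n : ℕ) : A := v.getD n ⊥

theorem exists_word {l : List A} (hl : ∀ a, a ∈ l) (N : ℕ) (h : ℕ → A) :
    ∃ v ∈ words l N, ∀ n < N, valuation v n = h n := by
  induction N generalizing h with
  | zero => exact ⟨[], by simp [words], by simp⟩
  | succ N ih =>
    obtain ⟨v, hv, hvh⟩ := ih fun n => h (n + 1)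
    refine ⟨h 0 :: v, List.mem_flatMap.2 ⟨v, hv, List.mem_map.2 ⟨h 0, hl _, rfl⟩⟩, ?_⟩
    rintro (_ | n) hn
    · simp [valuation]
    · simpa [valuation] using hvh n (by omega)

theorem entails_iff_words {l : List A} (hl : ∀ a, a ∈ l) (x : List Fm × Fm) :
    Entails A {ψ | ψ ∈ x.1} x.2 ↔ ∀ v ∈ words l (Encodable.encode x),
      (∀ ψ ∈ x.1, ψ.eval (valuation v) = ⊤) → x.2.eval (valuation v) = ⊤ := by
  refine ⟨fun H v _ hv => H _ hv, fun H h hΓ => ?_⟩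
  obtain ⟨v, hv, hvh⟩ := exists_word hl (Encodable.encode x) h
  -- The code of `x` bounds the codes of all its formulas, and these bound their variables, so words
  -- of that length suffice.
  have key : ∀ φ : Fm, Encodable.encode φ ≤ Encodable.encode x →
      φ.eval (valuation v) = φ.eval h := fun φ hφ =>
    Fm.eval_congr φ fun n hn => hvh n (hn.trans_le (φ.bound_le_enc.trans hφ))
  have h1 : ∀ ψ ∈ x.1, Encodable.encode ψ ≤ Encodable.encode x := fun ψ hψ =>
    (encode_le_of_mem_list hψ).trans (Nat.left_le_pair _ _)
  have h2 : Encodable.encode x.2 ≤ Encodable.encode x := Nat.right_le_pair _ _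
  rw [← key _ h2]
  refine H v hv fun ψ hψ => ?_
  rw [key _ (h1 ψ hψ)]
  exact hΓ ψ hψ

/-- One step of the evaluation of the formula with number `l.length` at `v`, where `l` lists the
values of the formulas with smaller numbers. -/
def evalStep (v l : List A) : A :=
  if l.length = 0 then ⊥
  else if l.length = 1 then ⊤
  else if (l.length - 2) % 5 = 0 then valuation v ((l.length - 2) / 5)
  else if (l.length - 2) % 5 = 1 then (valuation l ((l.length - 2) / 5))ᶜ
  else if (l.length - 2) % 5 = 2 then
    valuation l ((l.length - 2) / 5).unpair.1 ⊔ valuation l ((l.length - 2) / 5).unpair.2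
  else if (l.length - 2) % 5 = 3 then
    valuation l ((l.length - 2) / 5).unpair.1 ⊓ valuation l ((l.length - 2) / 5).unpair.2
  else
    valuation l ((l.length - 2) / 5).unpair.1 ⇨ valuation l ((l.length - 2) / 5).unpair.2

theorem evalStep_eq (v : List A) (n : ℕ) :
    evalStep v ((List.range n).map fun m => (Fm.dec m).eval (valuation v)) =
      (Fm.dec n).eval (valuation v) := by
  -- Immediate subformulas have smaller codes, so the lookups in `evalStep` never fall back on the
  -- default `⊥`.
  have get : ∀ m < n, valuation ((List.range n).map fun m => (Fm.dec m).eval (valuation v)) m =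
      (Fm.dec m).eval (valuation v) := by
    intro m hm
    simp [valuation, hm]
  match n with
  | 0 => simp [evalStep, Fm.dec, Fm.eval]
  | 1 => simp [evalStep, Fm.dec, Fm.eval]
  | m + 2 =>
    have h0 : m / 5 < m + 2 := by omega
    have g0 := get _ h0
    have g1 := get _ (lt_of_le_of_lt (Nat.unpair_left_le (m / 5)) h0)
    have g2 := get _ (lt_of_le_of_lt (Nat.unpair_right_le (m / 5)) h0)
    have hc : m % 5 = 0 ∨ m % 5 = 1 ∨ m % 5 = 2 ∨ m % 5 = 3 ∨ m % 5 = 4 := by omega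
    rw [Fm.dec, evalStep]
    simp only [List.length_map, List.length_range, Nat.add_sub_cancel, g0, g1, g2]
    rcases hc with h | h | h | h | h <;> simp [h, Fm.eval]

variable [Primcodable A]

theorem primrec_valuation : Primrec₂ (valuation : List A → ℕ → A) := Primrec.list_getD ⊥

variable [Finite A]

theorem primrec_evalStep : Primrec₂ (evalStep : List A → List A → A) := by
  have len : Primrec fun x : List A × List A => x.2.length :=
    Primrec.list_length.comp Primrec.snd
  have pre : Primrec fun x : List A × List A => x.2.length - 2 :=
    Primrec.nat_sub.comp len (Primrec.const 2)
  have quo : Primrec fun x : List A × List A => (x.2.length - 2) / 5 :=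
    Primrec.nat_div.comp pre (Primrec.const 5)
  have rem : Primrec fun x : List A × List A => (x.2.length - 2) % 5 :=
    Primrec.nat_mod.comp pre (Primrec.const 5)
  have hl := Primrec.fst.comp (Primrec.unpair.comp quo)
  have hr := Primrec.snd.comp (Primrec.unpair.comp quo)
  have val1 := primrec_valuation.comp (Primrec.snd (α := List A) (β := List A)) hl
  have val2 := primrec_valuation.comp (Primrec.snd (α := List A) (β := List A)) hr
  have test : ∀ {f : List A × List A → ℕ} (k : ℕ), Primrec f → PrimrecPred fun x => f x = k :=
    fun k hf => Primrec.eq.comp hf (Primrec.const k)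
  -- Every operation on a finite set is primitive recursive.
  have bin : ∀ op : A → A → A, Primrec₂ op := fun op =>
    Primrec.dom_finite fun x : A × A => op x.1 x.2
  exact Primrec.ite (test 0 len) (Primrec.const _) <|
    Primrec.ite (test 1 len) (Primrec.const _) <|
    Primrec.ite (test 0 rem) (primrec_valuation.comp Primrec.fst quo) <|
    Primrec.ite (test 1 rem)
      ((Primrec.dom_finite fun a : A => aᶜ).comp (primrec_valuation.comp Primrec.snd quo)) <|
    Primrec.ite (test 2 rem) ((bin (· ⊔ ·)).comp val1 val2) <|
    Primrec.ite (test 3 rem) ((bin (· ⊓ ·)).comp val1 val2) ((bin (· ⇨ ·)).comp val1 val2)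

/-- Course-of-values recursion on the code of the formula. -/
theorem primrec_eval : Primrec₂ fun (v : List A) (φ : Fm) => φ.eval (valuation v) := by
  have h : Primrec₂ fun (v : List A) (n : ℕ) => (Fm.dec n).eval (valuation v) :=
    Primrec.nat_strong_rec _ (Primrec.option_some.comp₂ primrec_evalStep)
      fun v n => congrArg some (evalStep_eq v n)
  refine (h.comp₂ Primrec₂.left (Primrec.encode.comp₂ Primrec₂.right)).of_eq fun v φ => ?_
  rw [encode_fm, Fm.dec_enc]

theorem computablePred_entails :
    ComputablePred fun x : List Fm × Fm => Entails A {ψ | ψ ∈ x.1} x.2 := by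
  obtain ⟨l, hl⟩ : ∃ l : List A, ∀ a, a ∈ l :=
    let ⟨s, hs⟩ := Set.finite_univ (α := A) |>.exists_finset
    ⟨s.toList, fun a => Finset.mem_toList.2 ((hs a).2 trivial)⟩
  have true_at : PrimrecRel fun (φ : Fm) (v : List A) => φ.eval (valuation v) = ⊤ :=
    Primrec.eq.comp (primrec_eval.comp Primrec.snd Primrec.fst) (Primrec.const ⊤)
  have premises : PrimrecRel fun (v : List A) (x : List Fm × Fm) =>
      ∀ ψ ∈ x.1, ψ.eval (valuation v) = ⊤ :=
    true_at.forall_mem_list.comp (Primrec.fst.comp Primrec.snd) Primrec.fst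
  have conclusion : PrimrecRel fun (v : List A) (x : List Fm × Fm) =>
      x.2.eval (valuation v) = ⊤ :=
    true_at.comp (Primrec.snd.comp Primrec.snd) Primrec.fst
  have main : PrimrecRel fun (v : List A) (x : List Fm × Fm) =>
      (∀ ψ ∈ x.1, ψ.eval (valuation v) = ⊤) → x.2.eval (valuation v) = ⊤ :=
    (PrimrecPred.or premises.not conclusion).of_eq fun _ => imp_iff_not_or.symm
  have all := main.forall_mem_list.comp ((primrec_words l).comp Primrec.encode)
    (Primrec.id (α := List Fm × Fm))
  exact (all.of_eq fun x => (entails_iff_words hl x).symm).computablePred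

end Evaluation

theorem computablePred_entails_label (i : Label) :
    ComputablePred fun x : List Fm × Fm => Entails i.alg.carrier {ψ | ψ ∈ x.1} x.2 := by
  cases i
  · exact @computablePred_entails (Fin 3) A1.ops _ _
  · exact @computablePred_entails (Fin 3) A2.ops _ _
  · exact @computablePred_entails (Fin 3) A3.ops _ _
  · exact @computablePred_entails (Fin 3) A4.ops _ _
  · exact @computablePred_entails (Fin 4) A5.ops _ _

theorem computablePred_and {α : Type*} [Primcodable α] {P R : α → Prop}
    (hP : ComputablePred P) (hR : ComputablePred R) : ComputablePred fun x => P x ∧ R x := by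
  classical
  obtain ⟨f, hf, rfl⟩ := ComputablePred.computable_iff.1 hP
  obtain ⟨g, hg, rfl⟩ := ComputablePred.computable_iff.1 hR
  exact ComputablePred.computable_iff.2
    ⟨fun x => f x && g x, Primrec.and.to_comp.comp hf hg, by simp⟩

theorem computablePred_forall_label {α : Type*} [Primcodable α] {P : Label → α → Prop}
    (hP : ∀ i, ComputablePred (P i)) : ComputablePred fun x => ∀ i, P i x := by
  refine (computablePred_and (hP .a1) (computablePred_and (hP .a2) (computablePred_and (hP .a3)
    (computablePred_and (hP .a4) (hP .a5))))).of_eq fun x => ?_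
  constructor
  · rintro ⟨h1, h2, h3, h4, h5⟩ (_ | _ | _ | _ | _) <;> assumption
  · exact fun h => ⟨h _, h _, h _, h _, h _⟩

theorem isDecidableLogic {W : Set Alg.{u}} (hW : IsVariety W) (hR : W ⊆ RUNO1)
    {L : Set Fm → Fm → Prop} (hL : IsLogicOf L W) : IsDecidableLogic L := by
  have H : ∀ i, ComputablePred fun x : List Fm × Fm =>
      i ∈ labels W → Entails i.alg.carrier {ψ | ψ ∈ x.1} x.2 := by
    intro i
    -- Membership in `labels W` does not depend on the input, so it may be decided classically. For
    -- the trivial variety all five conditions are vacuous.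
    by_cases hi : i ∈ labels W
    · simpa only [hi, true_imp_iff] using computablePred_entails_label i
    · simpa only [hi, false_imp_iff] using (PrimrecPred.computablePred
        ⟨fun _ => isTrue trivial, (Primrec.const true).of_eq fun _ => by simp⟩)
  refine (computablePred_forall_label H).of_eq fun x => ?_
  rw [hL.complete, hW.conseq_iff hR]

end RUNO

theorem theorem9p1 :
    -- each listed base axiomatizes, relative to `RUNO1`, the logic of the variety generated by
    -- the corresponding algebras
    (∀ b ∈ RUNO.bases, RUNO.IsLogicOf (RUNO.ext b.2) (RUNO.V.{u} b.1)) ∧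
    -- the varieties in the list are, without repetition, all the nontrivial subvarieties
    -- of `RUNO1`, and there are 31 of them
    Set.BijOn (fun b => RUNO.V.{u} b.1) {b | b ∈ RUNO.bases} RUNO.nontrivialSubvarieties.{u} ∧
    RUNO.nontrivialSubvarieties.{u}.ncard = 31 ∧
    -- the logic of every subvariety of `RUNO1` (the trivial one included) is decidable
    (∀ W : Set RUNO.Alg.{u}, RUNO.IsVariety W → W ⊆ RUNO.RUNO1 →
      ∀ L : Set RUNO.Fm → RUNO.Fm → Prop, RUNO.IsLogicOf L W → RUNO.IsDecidableLogic L) :=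
  ⟨fun _ hb => RUNO.isLogicOf_bases hb, RUNO.bijOn_bases, RUNO.ncard_nontrivialSubvarieties,
    fun _ hW hR _ hL => RUNO.isDecidableLogic hW hR hL⟩
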